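/- Let $k$ be a field. A barbell quiver is a finite quiver $Q$ with two distinct vertices $x$ and $y$ that consists exactly of the following three walks: a simple closed walk $C_L=\alpha\cdots\beta$ of positive length at $x$, whose first letter is an arrow $\beta$ leaving $x$ and whose last letter is an arrow $\alpha$ entering $x$; a simple closed walk $C_R=\gamma\cdots\delta$ of positive length at $y$, whose first letter is an arrow $\delta$ leaving $y$ and whose last letter is an arrow $\gamma$ entering $y$; and a simple walk $\mathfrak b=\theta_d^{\epsilon_d}\cdots\theta_1^{\epsilon_1}$ (the bar) of positive length $d$ from $x$ to $y$. (Words are read from right to left. The walks share no arrow, and no vertex except that the bar meets $C_L$ in $x$ and $C_R$ in $y$; the remaining arrows have arbitrary orientation; $\alpha=\beta$ and $\gamma=\delta$ are allowed.) The barbell algebra is $\Lambda=kQ/\langle \beta\alpha,\delta\gamma\rangle$, where $\beta\alpha$ is the path that runs first through $\alpha$ and then through $\beta$. A brick is a module whose endomorphism ring is a division ring. For a string $u$ let $M(u)$ be its string module. A factorisation $u=u_3u_2u_1$ into strings is a quotient factorisation if $u_1$ has length $0$ or ends with an inverse letter, and $u_3$ has length $0$ or starts with a direct letter; it is a submodule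 factorisation if $u_1$ has length $0$ or ends with a direct letter, and $u_3$ has length $0$ or starts with an inverse letter. An admissible pair for $u$ consists of a quotient factorisation $u=u_3u_2u_1$ and a submodule factorisation $u=v_3v_2v_1$ with $v_2=u_2$ or $v_2=u_2^{-1}$; it is trivial if its graph map $M(u)\twoheadrightarrow M(u_2)\cong M(v_2)\hookrightarrow M(u)$ is the identity. Proposition. For every barbell algebra $\Lambda$ over $k$ there are infinitely many isomorphism classes of finitely generated left $\Lambda$-modules that are bricks. Explicitly, let $w=\mathfrak b^{-1}C_R\,\mathfrak b\,C_L$ if $\epsilon_1=1$ (the first arrow of the bar leaves $x$) and $w=\mathfrak b^{-1}C_R^{-1}\,\mathfrak b\,C_L^{-1}$ if $\epsilon_1=-1$. Then, for every $m\ge 1$, the word $w^m$ is a string, the finitely generated module $M(w^m)$ is a brick, and every admissible pair of factorisations of $w^m$ is trivial; moreover, the modules $M(w^m)$, $m\geq 1$, are pairwise non-isomorphic. -/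

import Mathlib

universe u v w

noncomputable section

open Quiver

/-! ## Path algebras -/

/-- The underlying vector space of the path algebra `kQ` of a quiver with vertex set `V`: the
direct sum over all pairs of vertices `a`, `b` of the vector space with basis the paths from
`a` to `b` (`V` is finite, so that the direct sum is a product). -/
def PathAlgebra (k : Type u) (V : Type v) [Field k] [Quiver.{w} V] : Type (max u v w) :=
  ∀ a b : V, Path a b →₀ k

namespace PathAlgebra

variable {k : Type u} {V : Type v} [Field k] [Quiver.{w} V]

instance : AddCommGroup (PathAlgebra k V) :=
  inferInstanceAs (AddCommGroup (∀ a b : V, Path a b →₀ k))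

instance : Module k (PathAlgebra k V) :=
  inferInstanceAs (Module k (∀ a b : V, Path a b →₀ k))

@[ext] theorem ext {f g : PathAlgebra k V} (h : ∀ a b, f a b = g a b) : f = g :=
  funext fun a => funext fun b => h a b

theorem add_apply (f g : PathAlgebra k V) (a b : V) : (f + g) a b = f a b + g a b := rfl

theorem zero_apply (a b : V) : (0 : PathAlgebra k V) a b = 0 := rfl

theorem smul_apply (c : k) (f : PathAlgebra k V) (a b : V) : (c • f) a b = c • f a b := rfl

/-- Concatenation of paths (first `p : a → b`, then `q : b → c`), extended bilinearly. -/
def concat (k : Type u) {V : Type v} [Field k] [Quiver.{w} V] (a b c : V) :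
    (Path a b →₀ k) →ₗ[k] (Path b c →₀ k) →ₗ[k] (Path a c →₀ k) :=
  Finsupp.lsum k fun p => LinearMap.toSpanSingleton k _
    (Finsupp.lmapDomain k k fun q => p.comp q)

theorem concat_single (a b c : V) (p : Path a b) (q : Path b c) (r s : k) :
    concat k a b c (Finsupp.single p r) (Finsupp.single q s) =
      Finsupp.single (p.comp q) (r * s) := by
  simp [concat]

theorem concat_assoc (a b c d : V) (f : Path a b →₀ k) (g : Path b c →₀ k)
    (h : Path c d →₀ k) :
    concat k a c d (concat k a b c f g) h = concat k a b d f (concat k b c d g h) := by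
  induction f using Finsupp.induction_linear with
  | zero => simp
  | add f₁ f₂ h₁ h₂ => simp [h₁, h₂]
  | single p r =>
    induction g using Finsupp.induction_linear with
    | zero => simp
    | add f₁ f₂ h₁ h₂ => simp [h₁, h₂]
    | single q s =>
      induction h using Finsupp.induction_linear with
      | zero => simp
      | add f₁ f₂ h₁ h₂ => simp [h₁, h₂]
      | single t z => simp only [concat_single, mul_assoc, Path.comp_assoc]

theorem concat_nil_left (a b : V) (f : Path a b →₀ k) :
    concat k a a b (Finsupp.single Path.nil 1) f = f := by
  induction f using Finsupp.induction_linear with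
  | zero => simp
  | add f₁ f₂ h₁ h₂ => simp [h₁, h₂]
  | single p r => simp [concat_single]

theorem concat_nil_right (a b : V) (f : Path a b →₀ k) :
    concat k a b b f (Finsupp.single Path.nil 1) = f := by
  induction f using Finsupp.induction_linear with
  | zero => simp
  | add f₁ f₂ h₁ h₂ => simp [h₁, h₂]
  | single p r => simp [concat_single]

open Classical in
/-- The element of `kQ` given by a path. -/
def ofPath (k : Type u) {V : Type v} [Field k] [Quiver.{w} V] {a b : V} (p : Path a b) :
    PathAlgebra k V :=
  Pi.single a (Pi.single b (Finsupp.single p 1))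

open Classical in
/-- The unit is the sum of the lazy paths. -/
instance : One (PathAlgebra k V) :=
  ⟨fun a b => if h : a = b then Finsupp.single (h ▸ Path.nil) 1 else 0⟩

open Classical in
theorem one_def (a b : V) : (1 : PathAlgebra k V) a b =
    if h : a = b then Finsupp.single (h ▸ Path.nil) 1 else 0 := rfl

theorem one_self (a : V) : (1 : PathAlgebra k V) a a = Finsupp.single Path.nil 1 := by
  simp [one_def]

theorem one_ne {a b : V} (h : a ≠ b) : (1 : PathAlgebra k V) a b = 0 := by
  simp [one_def, h]

variable [Fintype V]

/-- The product is written from right to left as in `βα`: first the path in the right factor,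
then the path in the left factor. -/
instance : Mul (PathAlgebra k V) :=
  ⟨fun f g a c => ∑ b, concat k a b c (g a b) (f b c)⟩

theorem mul_apply (f g : PathAlgebra k V) (a c : V) :
    (f * g) a c = ∑ b, concat k a b c (g a b) (f b c) := rfl

instance : Ring (PathAlgebra k V) :=
  { (inferInstance : AddCommGroup (PathAlgebra k V)) with
    mul := (· * ·)
    one := 1
    left_distrib := fun f g h => by
      ext1 a b
      simp [mul_apply, add_apply, Finset.sum_add_distrib]
    right_distrib := fun f g h => by
      ext1 a b
      simp [mul_apply, add_apply, Finset.sum_add_distrib]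
    zero_mul := fun f => by
      ext1 a b
      simp [mul_apply, zero_apply]
    mul_zero := fun f => by
      ext1 a b
      simp [mul_apply, zero_apply]
    mul_assoc := fun f g h => by
      ext1 a d
      simp only [mul_apply, map_sum, LinearMap.sum_apply, concat_assoc]
      exact Finset.sum_comm
    one_mul := fun f => by
      ext1 a b
      rw [mul_apply, Finset.sum_eq_single b]
      · rw [one_self, concat_nil_right]
      · intro c _ hc
        rw [one_ne hc, map_zero]
      · simp
    mul_one := fun f => by
      ext1 a b
      rw [mul_apply, Finset.sum_eq_single a]
      · rw [one_self, concat_nil_left]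
      · intro c _ hc
        rw [one_ne hc.symm, map_zero, LinearMap.zero_apply]
      · simp }

instance : Algebra k (PathAlgebra k V) :=
  Algebra.ofModule
    (fun c f g => by
      ext1 a b
      simp [mul_apply, smul_apply, Finset.smul_sum])
    (fun c f g => by
      ext1 a b
      simp [mul_apply, smul_apply, Finset.smul_sum])

/-- Matrices `E a` (for the vertices) and `T e` (for the arrows) that describe a representation
of the quiver on a vector space with a basis indexed by `ι`: `E a` is the projection onto the
space at the vertex `a`, and `T e` is the map given by the arrow `e`. -/
structure MatrixRep (k : Type u) (V : Type v) [Field k] [Quiver.{w} V] [Fintype V]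
    (ι : Type) [Fintype ι] [DecidableEq ι] where
  E : V → Matrix ι ι k
  T : ∀ {a b : V}, (a ⟶ b) → Matrix ι ι k
  E_mul_self : ∀ a, E a * E a = E a
  E_mul_ne : ∀ a b, a ≠ b → E a * E b = 0
  E_sum : ∑ a, E a = 1
  E_mul_T : ∀ {a b : V} (e : a ⟶ b), E b * T e = T e
  T_mul_E : ∀ {a b : V} (e : a ⟶ b), T e * E a = T e

namespace MatrixRep

variable {ι : Type} [Fintype ι] [DecidableEq ι] (R : MatrixRep k V ι)

/-- The matrix by which a path acts. -/
def path {a : V} : ∀ {b : V}, Path a b → Matrix ι ι k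
  | _, .nil => R.E a
  | _, .cons p e => R.T e * path p

theorem E_mul_path {a b : V} (p : Path a b) : R.E b * R.path p = R.path p := by
  cases p with
  | nil => exact R.E_mul_self a
  | cons p e => rw [path, ← Matrix.mul_assoc, R.E_mul_T]

theorem path_mul_E {a b : V} (p : Path a b) : R.path p * R.E a = R.path p := by
  induction p with
  | nil => exact R.E_mul_self a
  | cons p e ih => rw [path, Matrix.mul_assoc, ih]

theorem path_comp {a b c : V} (p : Path a b) (q : Path b c) :
    R.path (p.comp q) = R.path q * R.path p := by
  induction q with
  | nil => rw [Path.comp_nil, path, E_mul_path]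
  | cons q e ih => rw [Path.comp_cons, path, path, ih, Matrix.mul_assoc]

theorem path_mul_path_ne {a b c d : V} (p : Path a b) (q : Path c d) (h : c ≠ b) :
    R.path q * R.path p = 0 := by
  rw [← R.path_mul_E q, ← R.E_mul_path p, Matrix.mul_assoc, ← Matrix.mul_assoc (R.E c),
    R.E_mul_ne c b h, Matrix.zero_mul, Matrix.mul_zero]

/-- The action of linear combinations of paths from `a` to `b`. -/
def lin (a b : V) : (Path a b →₀ k) →ₗ[k] Matrix ι ι k :=
  Finsupp.linearCombination k fun p => R.path p

theorem lin_single (a b : V) (p : Path a b) (r : k) :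
    R.lin a b (Finsupp.single p r) = r • R.path p := by
  simp [lin]

theorem lin_concat (a b c : V) (f : Path a b →₀ k) (g : Path b c →₀ k) :
    R.lin a c (concat k a b c f g) = R.lin b c g * R.lin a b f := by
  induction f using Finsupp.induction_linear with
  | zero => simp
  | add f₁ f₂ h₁ h₂ => simp [h₁, h₂, Matrix.mul_add]
  | single p r =>
    induction g using Finsupp.induction_linear with
    | zero => simp
    | add f₁ f₂ h₁ h₂ => simp [h₁, h₂, Matrix.add_mul]
    | single q s =>
      rw [concat_single, lin_single, lin_single, lin_single, path_comp, Matrix.smul_mul,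
        Matrix.mul_smul, smul_smul, mul_comm r s]

theorem lin_mul_ne (a b c d : V) (f : Path a b →₀ k) (g : Path c d →₀ k) (h : c ≠ b) :
    R.lin c d g * R.lin a b f = 0 := by
  induction f using Finsupp.induction_linear with
  | zero => simp
  | add f₁ f₂ h₁ h₂ => simp [h₁, h₂, Matrix.mul_add]
  | single p r =>
    induction g using Finsupp.induction_linear with
    | zero => simp
    | add f₁ f₂ h₁ h₂ => simp [h₁, h₂, Matrix.add_mul]
    | single q s =>
      simp [lin_single, R.path_mul_path_ne p q h]

/-- The representation as a linear map on the path algebra. -/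
def linAll : PathAlgebra k V →ₗ[k] Matrix ι ι k where
  toFun f := ∑ a, ∑ b, R.lin a b (f a b)
  map_add' f g := by simp [add_apply, Finset.sum_add_distrib]
  map_smul' c f := by simp [smul_apply, Finset.smul_sum]

theorem linAll_apply (f : PathAlgebra k V) : R.linAll f = ∑ a, ∑ b, R.lin a b (f a b) := rfl

theorem linAll_one : R.linAll 1 = 1 := by
  rw [linAll_apply, ← R.E_sum]
  refine Finset.sum_congr rfl fun a _ => ?_
  rw [Finset.sum_eq_single a]
  · rw [one_self, lin_single, one_smul, path]
  · intro b _ hb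
    rw [one_ne hb.symm, map_zero]
  · simp

theorem linAll_mul (f g : PathAlgebra k V) : R.linAll (f * g) = R.linAll f * R.linAll g := by
  have key : ∀ a b : V, R.linAll f * R.lin a b (g a b) = ∑ d, R.lin b d (f b d) *
      R.lin a b (g a b) := by
    intro a b
    rw [linAll_apply, Finset.sum_mul, Finset.sum_eq_single b]
    · rw [Finset.sum_mul]
    · intro c _ hc
      rw [Finset.sum_mul]
      exact Finset.sum_eq_zero fun d _ => R.lin_mul_ne _ _ _ _ _ _ hc
    · simp
  rw [R.linAll_apply g, Finset.mul_sum, R.linAll_apply]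
  refine Finset.sum_congr rfl fun a _ => ?_
  rw [Finset.mul_sum]
  simp only [key, mul_apply, map_sum, lin_concat]
  exact Finset.sum_comm

/-- The representation as a homomorphism from the path algebra to a matrix algebra. -/
def algHom : PathAlgebra k V →ₐ[k] Matrix ι ι k :=
  AlgHom.ofLinearMap R.linAll R.linAll_one R.linAll_mul

theorem algHom_ofPath {a b : V} (p : Path a b) : R.algHom (ofPath k p) = R.path p := by
  classical
  change ∑ c, ∑ d, R.lin c d (ofPath k p c d) = _
  rw [Finset.sum_eq_single a, Finset.sum_eq_single b]
  · simp [ofPath, lin_single]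
  · intro d _ hd
    simp [ofPath, hd]
  · simp
  · intro c _ hc
    refine Finset.sum_eq_zero fun d _ => ?_
    simp [ofPath, hc]
  · simp

end MatrixRep

end PathAlgebra

/-! ## Monomial bound quivers -/

/-- A set of paths of length at least two. -/
structure MonomialRelations (V : Type v) [Quiver.{w} V] where
  Mem : ∀ ⦃a b : V⦄, Path a b → Prop
  two_le : ∀ ⦃a b : V⦄ (p : Path a b), Mem p → 2 ≤ p.length

namespace MonomialRelations

variable {V : Type v} [Quiver.{w} V] [Fintype V]

/-- The two-sided ideal `I` of `kQ` generated by the given paths. -/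
def ideal (S : MonomialRelations V) (k : Type u) [Field k] : TwoSidedIdeal (PathAlgebra k V) :=
  TwoSidedIdeal.span {z | ∃ (a b : V) (p : Path a b), S.Mem p ∧ z = PathAlgebra.ofPath k p}

/-- The algebra `kQ/I`. -/
abbrev Algebra (S : MonomialRelations V) (k : Type u) [Field k] : Type (max u v w) :=
  (S.ideal k).ringCon.Quotient

end MonomialRelations

/-! ## Words and strings -/

/-- A letter is an arrow `γ`, written `(γ, true)`, or its formal inverse `γ⁻¹`, written
`(γ, false)`. -/
abbrev Letter (V : Type v) [Quiver.{w} V] : Type (max v w) := Total V × Bool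

namespace Letter

variable {V : Type v} [Quiver.{w} V]

/-- The start of a letter. -/
def src (c : Letter V) : V := if c.2 then c.1.left else c.1.right

/-- The end of a letter. -/
def tgt (c : Letter V) : V := if c.2 then c.1.right else c.1.left

/-- The inverse letter. -/
def inv (c : Letter V) : Letter V := (c.1, !c.2)

end Letter

/-- A word consists of a start vertex and of a list of letters in the order in which they are
run through: the word written `γ_k ⋯ γ_2 γ_1` has the list `[γ_1, γ_2, …, γ_k]`. The word of
length zero at the vertex `x` is `⟨x, []⟩`. -/
@[ext] structure Word (V : Type v) [Quiver.{w} V] where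
  start : V
  letters : List (Letter V)

namespace Word

variable {V : Type v} [Quiver.{w} V]

/-- The length of a word. -/
def length (w : Word V) : ℕ := w.letters.length

/-- The vertices visited by a word, one after the other (`length + 1` of them). -/
def vertices (w : Word V) : List V := w.start :: w.letters.map Letter.tgt

/-- The vertex at the position `i` of a word, `0 ≤ i ≤ length`. -/
def vertex (w : Word V) (i : ℕ) : V := w.vertices.getD i w.start

/-- The end vertex of a word. -/
def finish (w : Word V) : V := w.vertex w.length

/-- The inverse word. -/
def inv (w : Word V) : Word V := ⟨w.finish, (w.letters.map Letter.inv).reverse⟩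

/-- The word `v u` (first `u`, then `v`), to be used when `v` starts where `u` ends. -/
def comp (v u : Word V) : Word V := ⟨u.start, u.letters ++ v.letters⟩

/-- The power `w ^ m` of a word that ends where it starts. -/
def pow (w : Word V) (m : ℕ) : Word V := ⟨w.start, (List.replicate m w.letters).flatten⟩

/-- Consecutive letters fit together: every letter starts at the vertex reached so far. -/
def IsWalk (w : Word V) : Prop :=
  ∀ (i : ℕ) (c : Letter V), w.letters[i]? = some c → c.src = w.vertex i

/-- The letters of a path, which are all direct. -/
def lettersOfPath {a : V} : ∀ {b : V}, Path a b → List (Letter V)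
  | _, .nil => []
  | _, .cons p e => lettersOfPath p ++ [(⟨_, _, e⟩, true)]

theorem lettersOfPath_length {a b : V} (p : Path a b) :
    (lettersOfPath p).length = p.length := by
  induction p with
  | nil => rfl
  | cons p e ih => simp [lettersOfPath, ih]

/-- In the diagram of the string module, the arrow `e` maps the basis vector at the position `i`
to the one at the position `j`: either `e` is the letter between `i` and `j = i + 1`, or `e⁻¹`
is the letter between `j` and `i = j + 1`. -/
def Step (w : Word V) (e : Total V) (i j : ℕ) : Prop :=
  (j = i + 1 ∧ w.letters[i]? = some (e, true)) ∨ (i = j + 1 ∧ w.letters[j]? = some (e, false))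

theorem vertex_succ (w : Word V) {i : ℕ} {c : Letter V} (h : w.letters[i]? = some c) :
    w.vertex (i + 1) = c.tgt := by
  simp [vertex, vertices, List.getD, h]

theorem Step.src {w : Word V} (hw : w.IsWalk) {e : Total V} {i j : ℕ} (h : w.Step e i j) :
    w.vertex i = e.left := by
  rcases h with ⟨-, h⟩ | ⟨rfl, h⟩
  · rw [← hw _ _ h]; simp [Letter.src]
  · rw [w.vertex_succ h]; simp [Letter.tgt]

theorem Step.tgt {w : Word V} (hw : w.IsWalk) {e : Total V} {i j : ℕ} (h : w.Step e i j) :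
    w.vertex j = e.right := by
  rcases h with ⟨rfl, h⟩ | ⟨-, h⟩
  · rw [w.vertex_succ h]; simp [Letter.tgt]
  · rw [← hw _ _ h]; simp [Letter.src]

variable [Fintype V]

/-- A word is a string of `kQ/I` if it is a walk, no letter is followed by its inverse, and
neither the word nor its inverse contains a (direct) subpath that lies in `I`. -/
structure IsString (S : MonomialRelations V) (k : Type u) [Field k] (w : Word V) : Prop where
  isWalk : w.IsWalk
  reduced : w.letters.IsChain fun c d => d ≠ c.inv
  not_mem : ∀ {a b : V} (p : Path a b), 0 < p.length →
    (lettersOfPath p <:+: w.letters ∨ lettersOfPath p <:+: w.inv.letters) →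
      PathAlgebra.ofPath k p ∉ S.ideal k

/-! ## String modules -/

open Classical in
/-- The representation of the quiver given by a walk: one basis vector for every position
`0, …, length`, placed at the vertex visited there, and the arrows act by `Step`. -/
def matrixRep (k : Type u) [Field k] (w : Word V) (hw : w.IsWalk) :
    PathAlgebra.MatrixRep k V (Fin (w.length + 1)) where
  E a := Matrix.diagonal fun i => if w.vertex i = a then 1 else 0
  T e := Matrix.of fun j i => if w.Step ⟨_, _, e⟩ i j then 1 else 0
  E_mul_self a := by
    simp
  E_mul_ne a b h := by
    rw [Matrix.diagonal_mul_diagonal, ← Matrix.diagonal_zero]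
    congr 1
    funext i
    by_cases hi : w.vertex i = a
    · simp [hi, h]
    · simp [hi]
  E_sum := by
    ext i j
    rw [Matrix.sum_apply]
    by_cases h : i = j
    · subst h; simp
    · simp [h]
  E_mul_T {a b} e := by
    ext j i
    rw [Matrix.diagonal_mul]
    by_cases h : w.Step ⟨_, _, e⟩ i j
    · simp [h, h.tgt hw]
    · simp [h]
  T_mul_E {a b} e := by
    ext j i
    rw [Matrix.mul_diagonal]
    by_cases h : w.Step ⟨_, _, e⟩ i j
    · simp [h, h.src hw]
    · simp [h]

theorem matrixRep_path_ne_zero (k : Type u) [Field k] (w : Word V) (hw : w.IsWalk)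
    {a b : V} (p : Path a b) (j i : Fin (w.length + 1))
    (h : (w.matrixRep k hw).path p j i ≠ 0) :
    ((j : ℕ) = i + p.length ∧
        ∀ t, t < p.length → w.letters[(i : ℕ) + t]? = (lettersOfPath p)[t]?) ∨
      ((i : ℕ) = j + p.length ∧ ∀ t, t < p.length →
        w.letters[(j : ℕ) + t]? = ((lettersOfPath p).map Letter.inv).reverse[t]?) := by
  classical
  induction p generalizing j with
  | nil =>
    left
    refine ⟨?_, by simp⟩
    by_contra hne
    apply h
    have : j ≠ i := fun h' => hne (by simp [h'])
    simp [PathAlgebra.MatrixRep.path, matrixRep, Matrix.diagonal_apply_ne _ this]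
  | cons p e ih =>
    rw [PathAlgebra.MatrixRep.path, Matrix.mul_apply] at h
    obtain ⟨l, -, hl⟩ := Finset.exists_ne_zero_of_sum_ne_zero h
    have h1 : w.Step ⟨_, _, e⟩ l j := by
      by_contra hs
      apply hl
      simp [matrixRep, hs]
    have h2 := ih l (right_ne_zero_of_mul hl)
    have hlen := lettersOfPath_length p
    rcases h1 with ⟨hj, h1⟩ | ⟨hj, h1⟩
    · have hforw : (l : ℕ) = i + p.length ∧
          ∀ t, t < p.length → w.letters[(i : ℕ) + t]? = (lettersOfPath p)[t]? := by
        rcases h2 with h2 | ⟨h2, h3⟩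
        · exact h2
        · rcases Nat.eq_zero_or_pos p.length with h0 | h0
          · exact ⟨by omega, by intro t ht; omega⟩
          · exfalso
            have := h3 0 h0
            rw [Nat.add_zero, h1] at this
            cases p with
            | nil => simp at h0
            | cons p e' => simp [lettersOfPath, Letter.inv] at this
      left
      refine ⟨by simp; omega, fun t ht => ?_⟩
      rw [Path.length_cons] at ht
      rw [lettersOfPath]
      rcases Nat.lt_succ_iff_lt_or_eq.1 ht with ht | rfl
      · rw [hforw.2 t ht, List.getElem?_append_left (by omega)]
      · rw [← hforw.1, h1, List.getElem?_append_right (by omega)]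
        simp [hlen]
    · have hback : (i : ℕ) = l + p.length ∧ ∀ t, t < p.length →
          w.letters[(l : ℕ) + t]? = ((lettersOfPath p).map Letter.inv).reverse[t]? := by
        rcases h2 with ⟨h2, h3⟩ | h2
        · rcases Nat.eq_zero_or_pos p.length with h0 | h0
          · exact ⟨by omega, by intro t ht; omega⟩
          · exfalso
            have := h3 (p.length - 1) (by omega)
            have hjj : (i : ℕ) + (p.length - 1) = j := by omega
            rw [hjj, h1] at this
            cases p with
            | nil => simp at h0
            | cons p e' =>
              have hlen' := lettersOfPath_length p
              simp [lettersOfPath, ← hlen'] at this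
        · exact h2
      right
      refine ⟨by simp; omega, fun t ht => ?_⟩
      rw [lettersOfPath, List.map_append, List.reverse_append]
      cases t with
      | zero => simp [h1, Letter.inv]
      | succ t =>
        rw [Path.length_cons] at ht
        have hjl : (j : ℕ) + (t + 1) = l + t := by omega
        rw [hjl, hback.2 t (by omega)]
        simp

theorem infix_of_getElem? {α : Type*} (l m : List α) (i : ℕ)
    (h : ∀ t, t < m.length → l[i + t]? = m[t]?) : m <:+: l := by
  have : m = (l.drop i).take m.length := by
    apply List.ext_getElem?
    intro t
    rw [List.getElem?_take]
    split_ifs with ht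
    · rw [List.getElem?_drop, h t ht]
    · exact List.getElem?_eq_none (by omega)
  rw [this]
  exact ((List.take_prefix _ _).isInfix).trans (List.drop_suffix _ _).isInfix

theorem matrixRep_path_eq_zero (S : MonomialRelations V) (k : Type u) [Field k] (w : Word V)
    (hw : w.IsString S k) {a b : V} (p : Path a b) (hp : S.Mem p) :
    (w.matrixRep k hw.isWalk).path p = 0 := by
  ext j i
  by_contra hne
  have hlen := lettersOfPath_length p
  have hj := j.2
  have hi := i.2
  unfold length at hi hj
  refine hw.not_mem p (by have := S.two_le p hp; omega) ?_
    (TwoSidedIdeal.subset_span ⟨a, b, p, hp, rfl⟩)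
  rcases matrixRep_path_ne_zero k w hw.isWalk p j i hne with ⟨h1, h2⟩ | ⟨h1, h2⟩
  · left
    exact infix_of_getElem? _ _ i (by rwa [hlen])
  · right
    have h3 : ((lettersOfPath p).map Letter.inv).reverse <:+: w.letters :=
      infix_of_getElem? _ _ j (by simpa [hlen] using h2)
    have h4 := List.reverse_infix.2 (h3.map Letter.inv)
    have h5 : Letter.inv ∘ Letter.inv = (id : Letter V → Letter V) := by
      funext c
      simp [Letter.inv]
    simpa [inv, List.map_reverse, h5] using h4

/-- The action of `kQ/I` on the string module, as a homomorphism to a matrix algebra. -/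
def algebraHom (S : MonomialRelations V) (k : Type u) [Field k] (w : Word V)
    (hw : w.IsString S k) :
    S.Algebra k →+* Matrix (Fin (w.length + 1)) (Fin (w.length + 1)) k :=
  (S.ideal k).ringCon.lift (w.matrixRep k hw.isWalk).algHom.toRingHom (by
    have h : S.ideal k ≤ TwoSidedIdeal.ker
        (w.matrixRep k hw.isWalk).algHom.toRingHom := by
      refine TwoSidedIdeal.span_le.2 ?_
      rintro z ⟨a, b, p, hp, rfl⟩
      refine (TwoSidedIdeal.mem_ker _).2 ?_
      exact ((w.matrixRep k hw.isWalk).algHom_ofPath p).trans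
        (matrixRep_path_eq_zero S k w hw p hp)
    intro x y hxy
    have h2 := h ((TwoSidedIdeal.rel_iff _ _ _).1 hxy)
    rw [TwoSidedIdeal.mem_ker, map_sub, sub_eq_zero] at h2
    exact h2)

/-- The string module `M(w)`. -/
def StringModule {S : MonomialRelations V} {k : Type u} [Field k] {w : Word V}
    (_hw : w.IsString S k) : Type u := Fin (w.length + 1) → k

namespace StringModule

variable {S : MonomialRelations V} {k : Type u} [Field k] {w : Word V} (hw : w.IsString S k)

instance : AddCommGroup (StringModule hw) :=
  inferInstanceAs (AddCommGroup (Fin (w.length + 1) → k))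

/-- The left `kQ/I`-module structure of `M(w)`: an element acts through its matrix. -/
instance : Module (S.Algebra k) (StringModule hw) where
  smul r c := (algebraHom S k w hw r).mulVec c
  one_smul c := by
    change (algebraHom S k w hw 1).mulVec c = c
    rw [map_one]
    exact Matrix.one_mulVec c
  mul_smul r s c := by
    change (algebraHom S k w hw (r * s)).mulVec c =
      (algebraHom S k w hw r).mulVec ((algebraHom S k w hw s).mulVec c)
    rw [map_mul]
    exact (Matrix.mulVec_mulVec (c : Fin (w.length + 1) → k) _ _).symm
  smul_zero r := Matrix.mulVec_zero _
  smul_add r c d := Matrix.mulVec_add _ c d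
  add_smul r s c := by
    change (algebraHom S k w hw (r + s)).mulVec c =
      (algebraHom S k w hw r).mulVec c + (algebraHom S k w hw s).mulVec c
    rw [map_add]
    exact Matrix.add_mulVec _ _ c
  zero_smul c := by
    change (algebraHom S k w hw 0).mulVec c = 0
    rw [map_zero]
    exact Matrix.zero_mulVec c

end StringModule

/-! ## Factorisations, admissible pairs and graph maps -/

/-- A factorisation `u = u₃ u₂ u₁`. -/
structure Factorization (u : Word V) where
  u₃ : Word V
  u₂ : Word V
  u₁ : Word V
  start₂ : u₂.start = u₁.finish
  start₃ : u₃.start = u₂.finish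
  eq_comp : u = u₃.comp (u₂.comp u₁)

namespace Factorization

variable {u v : Word V}

/-- `u₁` is of length zero or ends with an inverse letter, and `u₃` is of length zero or starts
with a direct letter: the arrows next to `u₂` leave `u₂`. -/
def IsQuotient (F : Factorization u) : Prop :=
  (F.u₁.letters = [] ∨ ∃ γ, F.u₁.letters.getLast? = some (γ, false)) ∧
    (F.u₃.letters = [] ∨ ∃ θ, F.u₃.letters.head? = some (θ, true))

/-- `u₁` is of length zero or ends with a direct letter, and `u₃` is of length zero or starts
with an inverse letter: the arrows next to `u₂` enter `u₂`. -/
def IsSubmodule (F : Factorization u) : Prop :=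
  (F.u₁.letters = [] ∨ ∃ γ, F.u₁.letters.getLast? = some (γ, true)) ∧
    (F.u₃.letters = [] ∨ ∃ θ, F.u₃.letters.head? = some (θ, false))

/-- The pair `((u₃, u₂, u₁), (v₃, v₂, v₁))` is admissible. -/
def IsAdmissible (F : Factorization u) (G : Factorization v) : Prop :=
  F.IsQuotient ∧ G.IsSubmodule ∧ (F.u₂ = G.u₂ ∨ F.u₂ = G.u₂.inv)

open Classical in
/-- The graph map `M(u) → M(u₂) ≅ M(v₂) → M(v)` of an admissible pair, in the standard bases:
the basis vector at the position `t` of `u₂` goes to the one at the corresponding position of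
`v₂`, and the basis vectors at the positions outside `u₂` go to zero. -/
def graphMap (k : Type u) [Field k] (F : Factorization u) (G : Factorization v) :
    (Fin (u.length + 1) → k) →ₗ[k] (Fin (v.length + 1) → k) :=
  Matrix.toLin' (Matrix.of fun j i =>
    if ∃ t ≤ F.u₂.length, (i : ℕ) = F.u₁.length + t ∧
      (j : ℕ) = G.u₁.length + (if F.u₂ = G.u₂ then t else F.u₂.length - t) then 1 else 0)

end Factorization

end Word

/-! ## Bricks -/

/-- A module is a brick if its endomorphism ring is a division ring. -/
def IsBrick (R : Type*) [Ring R] (M : Type*) [AddCommGroup M] [Module R M] : Prop :=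
  Nontrivial (Module.End R M) ∧ ∀ f : Module.End R M, f ≠ 0 → IsUnit f

/-! ## Barbell algebras -/

/-- A barbell quiver: the vertex `x` lies on a cyclic walk `C_L = α ⋯ β` (which starts with the
arrow `β` leaving `x` and ends with the arrow `α` entering `x`), the vertex `y` on a cyclic walk
`C_R = γ ⋯ δ` (which starts with the arrow `δ` leaving `y` and ends with the arrow `γ` entering
`y`), and `x` and `y` are joined by the bar, a walk of positive length. All other arrows have
arbitrary orientation, and `α = β` or `γ = δ` is allowed. The three walks run through every
arrow of the quiver exactly once, and the only vertices that they visit more than once are the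
junctions `x` and `y`. -/
structure Barbell (V : Type v) [Quiver.{w} V] where
  (x y a b c d : V)
  α : a ⟶ x
  β : x ⟶ b
  γ : c ⟶ y
  δ : y ⟶ d
  /-- the left cyclic walk -/
  CL : Word V
  /-- the right cyclic walk -/
  CR : Word V
  /-- the bar -/
  bar : Word V
  isWalk_CL : CL.IsWalk
  isWalk_CR : CR.IsWalk
  isWalk_bar : bar.IsWalk
  start_CL : CL.start = x
  finish_CL : CL.finish = x
  start_CR : CR.start = y
  finish_CR : CR.finish = y
  start_bar : bar.start = x
  finish_bar : bar.finish = y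
  head_CL : CL.letters.head? = some (⟨x, b, β⟩, true)
  last_CL : CL.letters.getLast? = some (⟨a, x, α⟩, true)
  head_CR : CR.letters.head? = some (⟨y, d, δ⟩, true)
  last_CR : CR.letters.getLast? = some (⟨c, y, γ⟩, true)
  bar_pos : 0 < bar.length
  arrows_nodup : ((CL.letters ++ bar.letters ++ CR.letters).map Prod.fst).Nodup
  arrows_all : ∀ e : Total V, e ∈ (CL.letters ++ bar.letters ++ CR.letters).map Prod.fst
  /-- the inner vertices of `C_L`, then `x`, the inner vertices of the bar, then `y`, the inner
  vertices of `C_R` -/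
  vertices_nodup :
    (CL.vertices.tail ++ bar.vertices.tail ++ CR.vertices.tail.dropLast).Nodup
  vertices_all : ∀ z : V,
    z ∈ CL.vertices.tail ++ bar.vertices.tail ++ CR.vertices.tail.dropLast

namespace Barbell

variable {V : Type v} [Quiver.{w} V]

/-- The two paths `βα` and `δγ`. -/
inductive Rel (B : Barbell V) : ∀ ⦃a b : V⦄, Path a b → Prop
  | left : Rel B (B.α.toPath.comp B.β.toPath)
  | right : Rel B (B.γ.toPath.comp B.δ.toPath)

/-- The relations `βα` and `δγ`. -/
def relations (B : Barbell V) : MonomialRelations V where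
  Mem := B.Rel
  two_le := by
    rintro _ _ _ (_ | _)
    · exact le_rfl
    · exact le_rfl

/-- The barbell algebra `kQ/⟨βα, δγ⟩`. -/
abbrev Algebra [Fintype V] (B : Barbell V) (k : Type u) [Field k] : Type (max u v w) :=
  B.relations.Algebra k

open Classical in
/-- The word `𝔟⁻¹ C_R 𝔟 C_L` if the first letter of the bar `𝔟` is direct (an arrow leaving
`x`), and `𝔟⁻¹ C_R⁻¹ 𝔟 C_L⁻¹` otherwise. -/
def word (B : Barbell V) : Word V :=
  if ∃ θ, B.bar.letters.head? = some (θ, true) then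
    B.bar.inv.comp (B.CR.comp (B.bar.comp B.CL))
  else
    B.bar.inv.comp (B.CR.inv.comp (B.bar.comp B.CL.inv))

end Barbell

end

/-! Let `f` be an endomorphism of a string module `M(u)`, and write `R i j` if `f` sends the basis
vector at `i` to a combination with nonzero coefficient at `j`. Since `f` commutes with the algebra,
related positions lie at the same vertex, an arrow ending at `i` also ends at `j`, an arrow starting
at `j` also starts at `i`, and the other ends of these arrows are again related
(`isGraphLike_endMatrix`). The matching of positions given by an admissible pair of factorisations
has the same properties (`isGraphLike_of_isAdmissible`). So everything reduces to one combinatorial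
fact: on `w^m` such a relation lies in the diagonal (`IsRigid`). Then the matrix of `f` is diagonal
and, the word being connected, scalar (`endMatrix_eq_smul_one`), and the graph map of an admissible
pair is the identity (`IsRigid.graphMap_eq_id`).

For rigidity (`Dumbbell.isRigid_pow`), write `w = b⁻¹ Q b P`, where the loops `P` and `Q` are run
through so that their first and last letters have the same sign as the first letter of the bar. As
the walks meet only in the junctions, two positions at the same vertex are congruent modulo the
length of `w`, or lie at the same place of the bar on a copy of `b` and a copy of `b⁻¹`
(`cases_of_vertex_eq`). A related pair can be moved along letters that agree at both positions
(`IsGraphLike.move`). Distinct congruent positions slide until one is at an end of the word, where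
an arrow required by the other is missing. Opposite positions slide along the bar to a junction,
where the required neighbour has the wrong sign or the wrong arrow; only at the left end of the word
is there no room to slide, and there again an arrow is missing.

The powers are strings because their walk representation kills both relations but no path read off
in the word (`isString_of_path_eq_zero`). They give pairwise non-isomorphic modules because the
dimension grows with the exponent. -/

open Quiver

/-! ### Words: composites, inverses, powers, neighbouring positions, rigidity -/

namespace Letter

variable {V : Type v} [Quiver.{w} V]

@[simp] theorem inv_inv (c : Letter V) : c.inv.inv = c := by simp [inv]

@[simp] theorem src_inv (c : Letter V) : c.inv.src = c.tgt := by
  rcases c with ⟨e, _ | _⟩ <;> rfl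

@[simp] theorem tgt_inv (c : Letter V) : c.inv.tgt = c.src := by
  rcases c with ⟨e, _ | _⟩ <;> rfl

end Letter

namespace Word

variable {V : Type v} [Quiver.{w} V]

@[simp] theorem vertex_zero (w : Word V) : w.vertex 0 = w.start := rfl

theorem exists_letter (w : Word V) {i : ℕ} (h : i < w.length) :
    ∃ c, w.letters[i]? = some c :=
  ⟨_, List.getElem?_eq_getElem h⟩

theorem lt_length_of_getElem? {w : Word V} {i : ℕ} {c : Letter V}
    (h : w.letters[i]? = some c) : i < w.length :=
  (List.getElem?_eq_some_iff.1 h).1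

/-! ### Vertices of composites and inverses -/

theorem length_comp (v u : Word V) : (v.comp u).length = u.length + v.length := by
  simp [comp, length]

theorem length_inv (u : Word V) : u.inv.length = u.length := by
  simp [inv, length]

theorem getElem?_comp_left (v u : Word V) {i : ℕ} (h : i < u.length) :
    (v.comp u).letters[i]? = u.letters[i]? :=
  List.getElem?_append_left h

theorem getElem?_comp_right (v u : Word V) (i : ℕ) :
    (v.comp u).letters[u.length + i]? = v.letters[i]? := by
  rw [comp, length, List.getElem?_append_right (by omega)]
  congr 1
  omega

theorem vertex_comp_left (v u : Word V) {i : ℕ} (h : i ≤ u.length) :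
    (v.comp u).vertex i = u.vertex i := by
  cases i with
  | zero => rfl
  | succ i =>
    obtain ⟨c, hc⟩ := u.exists_letter h
    rw [vertex_succ _ hc, vertex_succ _ ((getElem?_comp_left v u h).trans hc)]

theorem vertex_comp_right {v u : Word V} (hvu : v.start = u.finish) {i : ℕ}
    (h : i ≤ v.length) : (v.comp u).vertex (u.length + i) = v.vertex i := by
  cases i with
  | zero => rw [Nat.add_zero, vertex_comp_left _ _ le_rfl, vertex_zero, hvu, finish]
  | succ i =>
    obtain ⟨c, hc⟩ := v.exists_letter h
    rw [vertex_succ _ hc, ← Nat.add_assoc, vertex_succ _ ((getElem?_comp_right v u i).trans hc)]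

theorem finish_comp {v u : Word V} (hvu : v.start = u.finish) :
    (v.comp u).finish = v.finish := by
  rw [finish, length_comp, vertex_comp_right hvu le_rfl, finish]

theorem getElem?_inv (u : Word V) {i : ℕ} (h : i < u.length) :
    u.inv.letters[i]? = (u.letters[u.length - 1 - i]?).map Letter.inv := by
  unfold length at h
  rw [inv, List.getElem?_reverse (by simpa using h)]
  simp [length]

theorem vertex_inv {u : Word V} (hu : u.IsWalk) {i : ℕ} (h : i ≤ u.length) :
    u.inv.vertex i = u.vertex (u.length - i) := by
  cases i with
  | zero => rfl
  | succ i =>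
    obtain ⟨c, hc⟩ := u.exists_letter (i := u.length - 1 - i) (by omega)
    have h1 : u.inv.letters[i]? = some c.inv := by rw [getElem?_inv u h, hc]; rfl
    rw [vertex_succ _ h1, Letter.tgt_inv, hu _ _ hc]
    congr 1
    omega

theorem finish_inv {u : Word V} (hu : u.IsWalk) : u.inv.finish = u.start := by
  rw [finish, length_inv, vertex_inv hu le_rfl, Nat.sub_self, vertex_zero]

theorem IsWalk.comp {v u : Word V} (hv : v.IsWalk) (hu : u.IsWalk) (h : v.start = u.finish) :
    (v.comp u).IsWalk := by
  intro i c hc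
  have hlt := lt_length_of_getElem? hc
  rw [length_comp] at hlt
  by_cases hi : i < u.length
  · rw [getElem?_comp_left v u hi] at hc
    rw [vertex_comp_left v u hi.le, hu _ _ hc]
  · obtain ⟨j, rfl⟩ := Nat.exists_eq_add_of_le (not_lt.1 hi)
    rw [getElem?_comp_right] at hc
    rw [vertex_comp_right h (by omega), hv _ _ hc]

theorem IsWalk.inv {u : Word V} (hu : u.IsWalk) : u.inv.IsWalk := by
  intro i c hc
  have hlt := lt_length_of_getElem? hc
  rw [length_inv] at hlt
  obtain ⟨c', hc'⟩ := u.exists_letter (i := u.length - 1 - i) (by omega)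
  rw [getElem?_inv u hlt, hc'] at hc
  obtain rfl : c'.inv = c := by simpa using hc
  rw [vertex_inv hu hlt.le, Letter.src_inv, ← vertex_succ _ hc']
  congr 1
  omega

theorem vertices_getElem? (u : Word V) {i : ℕ} (h : i ≤ u.length) :
    u.vertices[i]? = some (u.vertex i) := by
  have : i < u.vertices.length := by simp [vertices]; exact h
  simp [vertex, List.getD, this]

theorem length_vertices (u : Word V) : u.vertices.length = u.length + 1 := by
  simp [vertices, length]

theorem vertices_inv {u : Word V} (hu : u.IsWalk) : u.inv.vertices = u.vertices.reverse := by
  apply List.ext_getElem?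
  intro i
  by_cases h : i ≤ u.length
  · rw [vertices_getElem? _ (by rwa [length_inv]), vertex_inv hu h,
      List.getElem?_reverse (by rw [length_vertices]; omega), length_vertices,
      ← vertices_getElem? _ (by omega)]
    congr 1
  · rw [List.getElem?_eq_none (by rw [length_vertices, length_inv]; omega),
      List.getElem?_eq_none (by rw [List.length_reverse, length_vertices]; omega)]

/-! ### Powers of closed words -/

theorem length_pow (u : Word V) (m : ℕ) : (u.pow m).length = m * u.length := by
  simp [pow, length]

theorem getElem?_pow (u : Word V) {m a r : ℕ} (ha : a < m) (hr : r < u.length) :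
    (u.pow m).letters[a * u.length + r]? = u.letters[r]? := by
  induction m generalizing a with
  | zero => omega
  | succ m ih =>
    have hs : (u.pow (m + 1)).letters = u.letters ++ (u.pow m).letters := by
      simp [pow, List.replicate_succ]
    rw [hs]
    cases a with
    | zero => rw [Nat.zero_mul, Nat.zero_add, List.getElem?_append_left hr]
    | succ a =>
      rw [List.getElem?_append_right (by
        rw [Nat.succ_mul]; change u.length ≤ _; omega), ← ih (a := a) (by omega)]
      congr 1
      rw [Nat.succ_mul]; change _ - u.length = _; omega

theorem getElem?_pow_mod (u : Word V) {m i : ℕ} (hi : i < m * u.length) :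
    (u.pow m).letters[i]? = u.letters[i % u.length]? := by
  have hpos : 0 < u.length := Nat.pos_of_ne_zero fun h => by simp [h] at hi
  rw [← getElem?_pow u ((Nat.div_lt_iff_lt_mul hpos).2 hi) (Nat.mod_lt _ hpos),
    Nat.mul_comm, Nat.div_add_mod]

theorem vertex_pow {u : Word V} (hu : u.finish = u.start) {m a r : ℕ} (ha : a < m)
    (hr : r ≤ u.length) : (u.pow m).vertex (a * u.length + r) = u.vertex r := by
  cases r with
  | succ r =>
    obtain ⟨c, hc⟩ := u.exists_letter hr
    rw [vertex_succ _ hc, ← Nat.add_assoc, vertex_succ _ ((getElem?_pow u ha hr).trans hc)]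
  | zero =>
    cases a with
    | zero => simp [pow]
    | succ a =>
      have he : (a + 1) * u.length + 0 = a * u.length + u.length := by ring
      rw [he, vertex_zero]
      rcases Nat.eq_zero_or_pos u.length with h0 | h0
      · simp [h0, pow]
      · obtain ⟨c, hc⟩ := u.exists_letter (i := u.length - 1) (by omega)
        have h1 := vertex_succ _ ((getElem?_pow u (m := m) (a := a) (by omega)
          (by omega)).trans hc)
        have h2 := vertex_succ _ hc
        rw [Nat.sub_add_cancel h0] at h2
        rw [Nat.add_assoc, Nat.sub_add_cancel h0] at h1
        rw [h1, ← h2, ← hu, finish]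

theorem IsWalk.pow {u : Word V} (hu : u.IsWalk) (h : u.finish = u.start) (m : ℕ) :
    (u.pow m).IsWalk := by
  intro i c hc
  have hlt := lt_length_of_getElem? hc
  rw [length_pow] at hlt
  have hpos : 0 < u.length := Nat.pos_of_ne_zero fun h => by simp [h] at hlt
  rw [getElem?_pow_mod u hlt] at hc
  have h1 := vertex_pow h ((Nat.div_lt_iff_lt_mul hpos).2 hlt) (Nat.mod_lt i hpos).le
  rw [Nat.mul_comm, Nat.div_add_mod] at h1
  rw [h1, hu _ _ hc]

/-! ### Neighbouring positions -/

/-- The positions `i` and `j` are neighbours joined by the arrow `e`, which leads from `i` to `j`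
if the sign `τ` is `true`, and from `j` to `i` otherwise. -/
def Adj (w : Word V) (e : Total V) (τ : Bool) (i j : ℕ) : Prop :=
  (j = i + 1 ∧ w.letters[i]? = some (e, τ)) ∨ (i = j + 1 ∧ w.letters[j]? = some (e, !τ))

theorem adj_not {w : Word V} {e : Total V} {τ : Bool} {i j : ℕ} :
    w.Adj e (!τ) i j ↔ w.Adj e τ j i := by
  unfold Adj
  rw [Bool.not_not, or_comm]

theorem adj_true {w : Word V} {e : Total V} {i j : ℕ} : w.Adj e true i j ↔ w.Step e i j :=
  Iff.rfl

theorem adj_false {w : Word V} {e : Total V} {i j : ℕ} : w.Adj e false i j ↔ w.Step e j i :=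
  adj_not (τ := true)

theorem Adj.le {w : Word V} {e : Total V} {τ : Bool} {i j : ℕ} (h : w.Adj e τ i j) :
    i ≤ w.length ∧ j ≤ w.length := by
  rcases h with ⟨rfl, h⟩ | ⟨rfl, h⟩ <;> have := lt_length_of_getElem? h <;> omega

theorem reduced_getElem? {w : Word V} (hw : w.letters.IsChain fun c d => d ≠ c.inv) {i : ℕ}
    {c d : Letter V} (hc : w.letters[i]? = some c) (hd : w.letters[i + 1]? = some d) :
    d ≠ c.inv := by
  obtain ⟨hi, rfl⟩ := List.getElem?_eq_some_iff.1 hc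
  obtain ⟨hj, rfl⟩ := List.getElem?_eq_some_iff.1 hd
  exact hw.getElem i hj

/-- Two different neighbours of `i` would be `i - 1` and `i + 1`, and the letters on both sides of
`i` would be inverse to each other. Hence an arrow acts on the standard basis as a partial
injection. -/
theorem Adj.unique {w : Word V} (hw : w.letters.IsChain fun c d => d ≠ c.inv) {e : Total V}
    {τ : Bool} {i j j' : ℕ} (h : w.Adj e τ i j) (h' : w.Adj e τ i j') : j = j' := by
  rcases h with ⟨rfl, h⟩ | ⟨rfl, h⟩ <;> rcases h' with ⟨h1, h'⟩ | ⟨h1, h'⟩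
  · exact h1.symm
  · subst h1
    exact absurd (by simp [Letter.inv]) (reduced_getElem? hw h' h)
  · exact absurd (by simp [Letter.inv]) (reduced_getElem? hw h h')
  · omega

theorem isChain_of_getElem? {w : Word V}
    (h : ∀ i c d, w.letters[i]? = some c → w.letters[i + 1]? = some d → d ≠ c.inv) :
    w.letters.IsChain fun c d => d ≠ c.inv :=
  List.isChain_iff_getElem.2 fun i hi => h i _ _
    (List.getElem?_eq_getElem _) (List.getElem?_eq_getElem hi)

/-- The sign stays the same, because inversion changes both the sign of the letter and the order of
its two ends. -/
theorem adj_inv {u : Word V} {e : Total V} {τ : Bool} {i j : ℕ} (hi : i ≤ u.length)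
    (hj : j ≤ u.length) :
    u.inv.Adj e τ i j ↔ u.Adj e τ (u.length - i) (u.length - j) := by
  have key : ∀ (τ : Bool) (i : ℕ), i < u.length →
      (u.inv.letters[i]? = some (e, τ) ↔ u.letters[u.length - (i + 1)]? = some (e, !τ)) := by
    intro τ i h
    obtain ⟨c, hc⟩ := u.exists_letter (i := u.length - 1 - i) (by omega)
    rw [getElem?_inv u h, hc, ← Nat.sub_sub, Nat.sub_right_comm, hc]
    rcases c with ⟨e', _ | _⟩ <;> cases τ <;> simp [Letter.inv]
  unfold Adj
  constructor
  · rintro (⟨rfl, h⟩ | ⟨rfl, h⟩)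
    · exact Or.inr ⟨by omega, (key _ _ (by omega)).1 h⟩
    · refine Or.inl ⟨by omega, ?_⟩
      have := (key _ _ (by omega)).1 h
      rwa [Bool.not_not] at this
  · rintro (⟨h1, h⟩ | ⟨h1, h⟩)
    · obtain rfl : i = j + 1 := by omega
      refine Or.inr ⟨rfl, (key _ _ (by omega)).2 ?_⟩
      rwa [Bool.not_not]
    · obtain rfl : j = i + 1 := by omega
      exact Or.inl ⟨rfl, (key _ _ (by omega)).2 h⟩

/-! ### Rigid words -/

/-- Properties that the support of an endomorphism of a string module has (for `σ = true`), as
a relation between positions of the word: arrows that end at `i` end at `j` as well, arrows that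
start at `j` start at `i` as well, and the relation is inherited along these arrows. For
`σ = false` the directions of all arrows are reversed. -/
structure IsGraphLike (w : Word V) (σ : Bool) (R : ℕ → ℕ → Prop) : Prop where
  le : ∀ {i j}, R i j → i ≤ w.length ∧ j ≤ w.length
  vertex : ∀ {i j}, R i j → w.vertex i = w.vertex j
  back : ∀ {i j e i'}, R i j → w.Adj e (!σ) i i' → ∃ j', w.Adj e (!σ) j j' ∧ R i' j'
  forth : ∀ {i j e j'}, R i j → w.Adj e σ j j' → ∃ i', w.Adj e σ i i' ∧ R i' j'

/-- Reversing all arrows exchanges `back` and `forth`. By this duality only relations whose sign is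
that of the dumbbell have to be studied. -/
theorem IsGraphLike.swap {w : Word V} {σ : Bool} {R : ℕ → ℕ → Prop} (h : w.IsGraphLike σ R) :
    w.IsGraphLike (!σ) (fun i j => R j i) where
  le hR := (h.le hR).symm
  vertex hR := (h.vertex hR).symm
  back hR hA := h.forth hR (by rwa [Bool.not_not] at hA) |>.imp fun _ h' =>
    ⟨by rw [Bool.not_not]; exact h'.1, h'.2⟩
  forth hR hA := h.back hR hA

/-- The tool for sliding a related pair along the word: depending on the sign, `forth` or `back`
supplies some neighbour, and `Adj.unique` identifies it with the given one. -/
theorem IsGraphLike.move {w : Word V} {σ : Bool} {R : ℕ → ℕ → Prop} (h : w.IsGraphLike σ R)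
    (hw : w.letters.IsChain fun c d => d ≠ c.inv) {i j i' j' : ℕ} {e : Total V} {τ : Bool}
    (hR : R i j) (hi : w.Adj e τ i i') (hj : w.Adj e τ j j') : R i' j' := by
  by_cases hτ : τ = σ
  · subst hτ
    obtain ⟨l, hl, hR'⟩ := h.forth hR hj
    rwa [hi.unique hw hl]
  · obtain rfl : τ = !σ := by cases τ <;> cases σ <;> simp_all
    obtain ⟨l, hl, hR'⟩ := h.back hR hi
    rwa [hj.unique hw hl]

/-- A word on which only the diagonal is graph-like. -/
def IsRigid (w : Word V) : Prop :=
  ∀ R : ℕ → ℕ → Prop, w.IsGraphLike true R → ∀ i j, R i j → i = j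

end Word

/-! ### Admissible pairs on rigid words, and a criterion for strings -/

namespace Word

variable {V : Type v} [Quiver.{w} V]

/-! ### Graph maps -/

namespace Factorization

variable {u : Word V}

theorem length_eq (F : Factorization u) :
    u.length = F.u₁.length + (F.u₂.length + F.u₃.length) := by
  have h := congrArg length F.eq_comp
  rw [length_comp, length_comp] at h
  omega

theorem getElem?_left (F : Factorization u) {i : ℕ} (hi : i < F.u₁.length) :
    u.letters[i]? = F.u₁.letters[i]? := by
  refine (congrArg (fun v : Word V => v.letters[i]?) F.eq_comp).trans ?_
  rw [getElem?_comp_left _ _ (by rw [length_comp]; omega), getElem?_comp_left _ _ hi]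

theorem getElem?_middle (F : Factorization u) {t : ℕ} (ht : t < F.u₂.length) :
    u.letters[F.u₁.length + t]? = F.u₂.letters[t]? := by
  refine (congrArg (fun v : Word V => v.letters[F.u₁.length + t]?) F.eq_comp).trans ?_
  rw [getElem?_comp_left _ _ (by rw [length_comp]; omega), getElem?_comp_right]

theorem getElem?_right (F : Factorization u) (t : ℕ) :
    u.letters[F.u₁.length + F.u₂.length + t]? = F.u₃.letters[t]? := by
  refine (congrArg (fun v : Word V => v.letters[F.u₁.length + F.u₂.length + t]?)
    F.eq_comp).trans ?_
  rw [← length_comp F.u₂ F.u₁, getElem?_comp_right]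

theorem vertex_middle (F : Factorization u) {t : ℕ} (ht : t ≤ F.u₂.length) :
    u.vertex (F.u₁.length + t) = F.u₂.vertex t := by
  refine (congrArg (fun v : Word V => v.vertex (F.u₁.length + t)) F.eq_comp).trans ?_
  rw [vertex_comp_left _ _ (by rw [length_comp]; omega),
    vertex_comp_right F.start₂ ht]

theorem isWalk_middle (F : Factorization u) (hu : u.IsWalk) : F.u₂.IsWalk := by
  intro t c hc
  have ht := lt_length_of_getElem? hc
  rw [← F.vertex_middle ht.le]
  exact hu _ _ ((F.getElem?_middle ht).trans hc)

theorem adj_middle (F : Factorization u) {e : Total V} {τ : Bool} {t t' : ℕ}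
    (h : F.u₂.Adj e τ t t') : u.Adj e τ (F.u₁.length + t) (F.u₁.length + t') := by
  rcases h with ⟨rfl, h⟩ | ⟨rfl, h⟩
  · exact Or.inl ⟨rfl, (F.getElem?_middle (lt_length_of_getElem? h)).trans h⟩
  · exact Or.inr ⟨rfl, (F.getElem?_middle (lt_length_of_getElem? h)).trans h⟩

/-- The common form of the conditions `IsQuotient` (`τ = false`) and `IsSubmodule`
(`τ = true`). -/
def IsBoundary (F : Factorization u) (τ : Bool) : Prop :=
  (F.u₁.letters = [] ∨ ∃ γ, F.u₁.letters.getLast? = some (γ, τ)) ∧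
    (F.u₃.letters = [] ∨ ∃ θ, F.u₃.letters.head? = some (θ, !τ))

/-- The letters next to `u₂` have the signs for which a step of sign `τ` across the boundary leads
into `u₂`; so none leads out of it. -/
theorem IsBoundary.exists_adj {F : Factorization u} {τ : Bool} (hF : F.IsBoundary τ)
    {e : Total V} {t i : ℕ} (ht : t ≤ F.u₂.length) (h : u.Adj e τ (F.u₁.length + t) i) :
    ∃ t' ≤ F.u₂.length, i = F.u₁.length + t' ∧ F.u₂.Adj e τ t t' := by
  rcases h with ⟨rfl, h⟩ | ⟨h0, h⟩
  · rcases ht.lt_or_eq with ht | rfl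
    · rw [F.getElem?_middle ht] at h
      exact ⟨t + 1, ht, rfl, Or.inl ⟨rfl, h⟩⟩
    · have h' := F.getElem?_right 0
      rw [Nat.add_zero, h] at h'
      rcases hF.2 with h0 | ⟨θ, h0⟩
      · simp [h0] at h'
      · rw [List.head?_eq_getElem?] at h0
        simp [h0] at h'
  · rcases Nat.eq_zero_or_pos t with rfl | ht0
    · rw [F.getElem?_left (by omega)] at h
      have hl := lt_length_of_getElem? h
      rcases hF.1 with h1 | ⟨γ, h1⟩
      · simp [h1] at h
      · rw [List.getLast?_eq_getElem?] at h1
        have h2 : F.u₁.letters.length - 1 = i := by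
          change F.u₁.length - 1 = i
          omega
        simp [h2, h] at h1
    · obtain ⟨t, rfl⟩ := Nat.exists_eq_succ_of_ne_zero ht0.ne'
      obtain rfl : i = F.u₁.length + t := by omega
      rw [F.getElem?_middle (by omega)] at h
      exact ⟨t, by omega, rfl, Or.inr ⟨rfl, h⟩⟩

end Factorization

open Classical in
theorem vertex_transport {p q : Word V} (hq : q.IsWalk) (h : p = q ∨ p = q.inv) {t : ℕ}
    (ht : t ≤ p.length) : p.vertex t = q.vertex (if p = q then t else p.length - t) := by
  split_ifs with h'
  · rw [h']
  · obtain rfl := h.resolve_left h'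
    rw [length_inv] at ht ⊢
    exact vertex_inv hq ht

open Classical in
theorem adj_transport {p q : Word V} (h : p = q ∨ p = q.inv) {e : Total V} {τ : Bool}
    {t t' : ℕ} (ht : t ≤ p.length) (ht' : t' ≤ p.length) :
    p.Adj e τ t t' ↔ q.Adj e τ (if p = q then t else p.length - t)
      (if p = q then t' else p.length - t') := by
  split_ifs with h'
  · rw [h']
  · obtain rfl := h.resolve_left h'
    rw [length_inv] at ht ht' ⊢
    exact adj_inv ht ht'

open Classical in
-- The quotient condition on `F` gives `back` and the submodule condition on `G` gives `forth`: each
-- keeps the relevant arrows inside the middle word, and there the two factorisations look alike up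
-- to inversion.
theorem isGraphLike_of_isAdmissible {u : Word V} (hu : u.IsWalk) {F G : Factorization u}
    (h : F.IsAdmissible G) :
    u.IsGraphLike true fun i j => ∃ t ≤ F.u₂.length, i = F.u₁.length + t ∧
      j = G.u₁.length + (if F.u₂ = G.u₂ then t else F.u₂.length - t) := by
  obtain ⟨hF, hG, h2⟩ := h
  have hF' : F.IsBoundary false := hF
  have hG' : G.IsBoundary true := hG
  have hlen : F.u₂.length = G.u₂.length := by
    rcases h2 with h2 | h2 <;> rw [h2]
    rw [length_inv]
  have hφ : ∀ t, t ≤ F.u₂.length →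
      (if F.u₂ = G.u₂ then t else F.u₂.length - t) ≤ G.u₂.length := by
    intro t ht
    split_ifs <;> omega
  constructor
  · rintro i j ⟨t, ht, rfl, rfl⟩
    have := hφ t ht
    have := F.length_eq
    have := G.length_eq
    omega
  · rintro i j ⟨t, ht, rfl, rfl⟩
    rw [F.vertex_middle ht, G.vertex_middle (hφ t ht),
      vertex_transport (G.isWalk_middle hu) h2 ht]
  · rintro i j e i' ⟨t, ht, rfl, rfl⟩ hA
    obtain ⟨t', ht', rfl, hA'⟩ := hF'.exists_adj ht hA
    exact ⟨_, G.adj_middle ((adj_transport h2 ht ht').1 hA'), t', ht', rfl, rfl⟩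
  · rintro i j e j' ⟨t, ht, rfl, rfl⟩ hA
    obtain ⟨s, hs, rfl, hA'⟩ := hG'.exists_adj (hφ t ht) hA
    obtain ⟨t', ht', rfl⟩ : ∃ t' ≤ F.u₂.length,
        s = if F.u₂ = G.u₂ then t' else F.u₂.length - t' := by
      split_ifs
      · exact ⟨s, by omega, rfl⟩
      · exact ⟨F.u₂.length - s, by omega, by omega⟩
    exact ⟨_, F.adj_middle ((adj_transport h2 ht ht').2 hA'), t', ht', rfl, rfl⟩

/-- By rigidity the partner supplied by `back` or `forth` is again diagonal, so one diagonal pair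
spreads letter by letter over the whole word. -/
theorem IsGraphLike.diagonal {u : Word V} (hu : u.IsRigid)
    {R : ℕ → ℕ → Prop} (h : u.IsGraphLike true R) {l : ℕ} (hl : R l l) :
    ∀ i ≤ u.length, R i i := by
  have step : ∀ {i j e τ}, R i i → u.Adj e τ i j → R j j := by
    intro i j e τ hR hA
    cases τ
    · obtain ⟨j', -, h2⟩ := h.back hR hA
      rwa [← hu R h _ _ h2] at h2
    · obtain ⟨j', -, h2⟩ := h.forth hR hA
      rwa [hu R h _ _ h2] at h2
  have up : ∀ i, R i i → i < u.length → R (i + 1) (i + 1) := by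
    intro i hR hi
    obtain ⟨⟨e, τ⟩, hc⟩ := u.exists_letter hi
    exact step hR (Or.inl ⟨rfl, hc⟩)
  have down : ∀ i, R (i + 1) (i + 1) → R i i := by
    intro i hR
    obtain ⟨⟨e, τ⟩, hc⟩ := u.exists_letter (h.le hR).1
    exact step (τ := !τ) hR (Or.inr ⟨rfl, by rwa [Bool.not_not]⟩)
  have h0 : R 0 0 := by
    clear * - down hl
    induction l with
    | zero => exact hl
    | succ l ih => exact ih (down l hl)
  intro i hi
  induction i with
  | zero => exact h0
  | succ i ih => exact up i (ih (by omega)) hi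

theorem IsRigid.graphMap_eq_id {u : Word V} (hr : u.IsRigid) (hu : u.IsWalk) (k : Type*)
    [Field k] {F G : Factorization u} (h : F.IsAdmissible G) :
    F.graphMap k G = LinearMap.id := by
  classical
  have hR := isGraphLike_of_isAdmissible hu h
  have hm : (Matrix.of fun j i : Fin (u.length + 1) =>
      if ∃ t ≤ F.u₂.length, (i : ℕ) = F.u₁.length + t ∧
        (j : ℕ) = G.u₁.length + (if F.u₂ = G.u₂ then t else F.u₂.length - t)
      then (1 : k) else 0) = 1 := by
    ext j i
    rw [Matrix.of_apply, Matrix.one_apply]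
    refine if_congr ⟨fun hij => Fin.ext (hr _ hR _ _ hij).symm, ?_⟩ rfl rfl
    rintro rfl
    -- The middle word has at least one position, so the relation is not empty and its first pair is
    -- a diagonal one to start from.
    have h0 := hr _ hR _ _ ⟨0, Nat.zero_le _, rfl, rfl⟩
    exact hR.diagonal hr (l := F.u₁.length + 0) ⟨0, Nat.zero_le _, rfl, h0⟩ _
      (Nat.lt_succ_iff.1 j.2)
  rw [Factorization.graphMap, ← Matrix.toLin'_one, ← hm]

/-! ### Recognising strings -/

theorem start_of_infix {u : Word V} (hu : u.IsWalk) {a b : V} (p : Path a b) (hp : 0 < p.length)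
    {i : ℕ} (h : ∀ t, t < p.length → u.letters[i + t]? = (lettersOfPath p)[t]?) :
    u.vertex i = a := by
  have key : ∀ {b : V} (p : Path a b), 0 < p.length →
      ∃ c, (lettersOfPath p)[0]? = some c ∧ c.src = a := by
    intro b p hp
    induction p with
    | nil => simp at hp
    | cons p e ih =>
      rcases Nat.eq_zero_or_pos p.length with h0 | h0
      · cases p with
        | nil => exact ⟨_, rfl, rfl⟩
        | cons p e => simp at h0
      · obtain ⟨c, hc, hs⟩ := ih h0
        refine ⟨c, ?_, hs⟩
        rw [lettersOfPath, List.getElem?_append_left (by rwa [lettersOfPath_length]), hc]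
  obtain ⟨c, hc, hs⟩ := key p hp
  rw [← hs, hu i c (by rw [← hc, ← h 0 hp, Nat.add_zero])]

variable [Fintype V]

/-- Arrows act as partial injections, so following the path along the positions `f 0, f 1, …` never
meets a second term. Paths occurring in the word therefore act as nonzero matrices. -/
theorem matrixRep_path_apply_ne_zero (k : Type u) [Field k] {u : Word V} (hu : u.IsWalk)
    (hred : u.letters.IsChain fun c d => d ≠ c.inv) {a b : V} (p : Path a b)
    (f : ℕ → Fin (u.length + 1)) (h0 : u.vertex (f 0) = a)
    (hf : ∀ t e, (lettersOfPath p)[t]? = some (e, true) → u.Step e (f t) (f (t + 1)))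
    (j : Fin (u.length + 1)) :
    (u.matrixRep k hu).path p j (f 0) = if j = f p.length then 1 else 0 := by
  classical
  induction p generalizing j with
  | nil =>
    by_cases hj : j = f 0
    · subst hj
      simp [PathAlgebra.MatrixRep.path, matrixRep, h0]
    · simp [PathAlgebra.MatrixRep.path, matrixRep, hj]
  | cons p e ih =>
    have hlen := lettersOfPath_length p
    have hs := hf p.length ⟨_, _, e⟩ (by simp [lettersOfPath, ← hlen])
    have ih' := ih fun t e' ht => hf t e' (by
      rw [lettersOfPath, List.getElem?_append_left (List.getElem?_eq_some_iff.1 ht).1, ht])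
    rw [PathAlgebra.MatrixRep.path, Matrix.mul_apply, Finset.sum_eq_single (f p.length)]
    · rw [ih' (f p.length), if_pos rfl, mul_one]
      simp only [matrixRep, Matrix.of_apply, Path.length_cons]
      refine if_congr ⟨fun h => ?_, fun h => h ▸ hs⟩ rfl rfl
      exact Fin.ext (Adj.unique hred (adj_true.2 h) (adj_true.2 hs))
    · intro l _ hl
      rw [ih' l, if_neg hl, mul_zero]
    · simp

theorem exists_index_of_infix {α : Type*} {l m : List α} (h : m <:+: l) :
    ∃ i, i + m.length ≤ l.length ∧ ∀ t, t < m.length → l[i + t]? = m[t]? := by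
  obtain ⟨s, r, rfl⟩ := h
  refine ⟨s.length, by simp, fun t ht => ?_⟩
  rw [List.append_assoc, List.getElem?_append_right (by omega), Nat.add_sub_cancel_left,
    List.getElem?_append_left ht]

/-- No description of the ideal is needed: the representation exists for every walk, it kills the
ideal once it kills the generators, and it does not kill a path contained in the word or in its
inverse. -/
theorem isString_of_path_eq_zero (S : MonomialRelations V) (k : Type u) [Field k] {u : Word V}
    (hu : u.IsWalk) (hred : u.letters.IsChain fun c d => d ≠ c.inv)
    (hS : ∀ {a b : V} (p : Path a b), S.Mem p → (u.matrixRep k hu).path p = 0) :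
    u.IsString S k := by
  refine ⟨hu, hred, ?_⟩
  intro a b p hp hinf hmem
  have h0 : (u.matrixRep k hu).path p = 0 := by
    have h : S.ideal k ≤ TwoSidedIdeal.ker (u.matrixRep k hu).algHom.toRingHom := by
      refine TwoSidedIdeal.span_le.2 ?_
      rintro z ⟨a, b, p, hp, rfl⟩
      exact (TwoSidedIdeal.mem_ker _).2 (((u.matrixRep k hu).algHom_ofPath p).trans (hS p hp))
    exact ((u.matrixRep k hu).algHom_ofPath p).symm.trans ((TwoSidedIdeal.mem_ker _).1 (h hmem))
  have hlen := lettersOfPath_length p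
  have contra : ∀ f : ℕ → Fin (u.length + 1), u.vertex (f 0) = a →
      (∀ t e, (lettersOfPath p)[t]? = some (e, true) → u.Step e (f t) (f (t + 1))) → False := by
    intro f hf0 hf
    have h := matrixRep_path_apply_ne_zero k hu hred p f hf0 hf (f p.length)
    rw [h0, if_pos rfl] at h
    exact zero_ne_one h
  rcases hinf with hinf | hinf
  · obtain ⟨i, hi, h⟩ := exists_index_of_infix hinf
    rw [hlen] at hi h
    change i + p.length ≤ u.length at hi
    -- `Fin.ofNat` only makes the function total; for `t ≤ p.length` there is no reduction. For the
    -- inverse word, the positions are counted from the right end instead.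
    refine contra (fun t => Fin.ofNat _ (i + t)) ?_ ?_
    · simpa [Nat.mod_eq_of_lt (show i < u.length + 1 by omega)] using start_of_infix hu p hp h
    · intro t e ht
      have htl := (List.getElem?_eq_some_iff.1 ht).1
      rw [hlen] at htl
      have h1 := h t htl
      rw [ht] at h1
      simp only [Fin.val_ofNat]
      rw [Nat.mod_eq_of_lt (by omega), Nat.mod_eq_of_lt (by omega)]
      exact Or.inl ⟨rfl, h1⟩
  · obtain ⟨i, hi, h⟩ := exists_index_of_infix hinf
    rw [hlen] at hi h
    change i + p.length ≤ u.inv.length at hi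
    rw [length_inv] at hi
    refine contra (fun t => Fin.ofNat _ (u.length - (i + t))) ?_ ?_
    · have h1 := start_of_infix hu.inv p hp h
      rw [vertex_inv hu (by omega)] at h1
      simpa [Nat.mod_eq_of_lt (show u.length - i < u.length + 1 by omega)] using h1
    · intro t e ht
      have htl := (List.getElem?_eq_some_iff.1 ht).1
      rw [hlen] at htl
      have h1 := h t htl
      rw [ht] at h1
      simp only [Fin.val_ofNat]
      rw [Nat.mod_eq_of_lt (by omega), Nat.mod_eq_of_lt (by omega)]
      exact (adj_inv (by omega) (by omega)).1 (Or.inl ⟨rfl, h1⟩)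

end Word

/-! ### Homomorphisms of string modules as matrices; rigid words give bricks -/

namespace Word

variable {V : Type v} [Quiver.{w} V] [Fintype V]

/-! ### Endomorphisms of string modules -/

namespace StringModule

variable {S : MonomialRelations V} {k : Type u} [Field k] {w : Word V} (hw : w.IsString S k)

/-- The coordinates of an element of a string module. -/
def vec : StringModule hw ≃+ (Fin (w.length + 1) → k) := AddEquiv.refl _

theorem vec_mk_smul (z : PathAlgebra k V) (c : StringModule hw) :
    vec hw ((z : S.Algebra k) • c) =
      ((w.matrixRep k hw.isWalk).algHom z).mulVec (vec hw c) := rfl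

/-- The field acts through multiples of the unit of `kQ`. Hence module homomorphisms are linear over
`k`, and matrices and dimensions become available. -/
theorem vec_scalar_smul (r : k) (c : StringModule hw) :
    vec hw (((algebraMap k (PathAlgebra k V) r : PathAlgebra k V) : S.Algebra k) • c) =
      r • vec hw c := by
  rw [vec_mk_smul, AlgHom.commutes, Algebra.algebraMap_eq_smul_one, Matrix.smul_mulVec,
    Matrix.one_mulVec]

/-- A homomorphism of string modules as a linear map over the field. -/
noncomputable def toLinear {w' : Word V} {hw : w.IsString S k} {hw' : w'.IsString S k}
    (f : StringModule hw →ₗ[S.Algebra k] StringModule hw') :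
    (Fin (w.length + 1) → k) →ₗ[k] (Fin (w'.length + 1) → k) where
  toFun c := vec hw' (f ((vec hw).symm c))
  map_add' c d := by simp
  map_smul' r c := by
    have h : (vec hw).symm (r • c) = ((algebraMap k (PathAlgebra k V) r : PathAlgebra k V) :
        S.Algebra k) • (vec hw).symm c := by
      rw [AddEquiv.symm_apply_eq, vec_scalar_smul, AddEquiv.apply_symm_apply]
    rw [h, map_smul, vec_scalar_smul, RingHom.id_apply]

theorem toLinear_apply {w' : Word V} {hw : w.IsString S k} {hw' : w'.IsString S k}
    (f : StringModule hw →ₗ[S.Algebra k] StringModule hw') (c : Fin (w.length + 1) → k) :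
    toLinear f c = vec hw' (f ((vec hw).symm c)) := rfl

theorem finite : Module.Finite (S.Algebra k) (StringModule hw) := by
  classical
  refine ⟨⟨Finset.univ.image fun i => (vec hw).symm (Pi.single i 1), ?_⟩⟩
  rw [eq_top_iff]
  intro c _
  have hc : c = ∑ i, ((algebraMap k (PathAlgebra k V) (vec hw c i) : PathAlgebra k V) :
      S.Algebra k) • (vec hw).symm (Pi.single i 1) := by
    apply (vec hw).injective
    rw [map_sum]
    simp only [vec_scalar_smul, AddEquiv.apply_symm_apply]
    exact pi_eq_sum_univ' (vec hw c)
  rw [hc]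
  refine Submodule.sum_mem _ fun i _ => Submodule.smul_mem _ _ (Submodule.subset_span ?_)
  simp

theorem length_eq_of_equiv {w' : Word V} {hw : w.IsString S k} {hw' : w'.IsString S k}
    (f : StringModule hw ≃ₗ[S.Algebra k] StringModule hw') : w.length = w'.length := by
  have e : (Fin (w.length + 1) → k) ≃ₗ[k] (Fin (w'.length + 1) → k) :=
    LinearEquiv.ofBijective (toLinear f.toLinearMap)
      ((vec hw').bijective.comp (f.bijective.comp (vec hw).symm.bijective))
  have h := e.finrank_eq
  simp only [Module.finrank_fin_fun] at h
  omega

/-- The matrix of an endomorphism. -/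
noncomputable def endMatrix {hw : w.IsString S k} (f : Module.End (S.Algebra k) (StringModule hw)) :
    Matrix (Fin (w.length + 1)) (Fin (w.length + 1)) k :=
  LinearMap.toMatrix' (toLinear f)

theorem vec_end_apply {hw : w.IsString S k} (f : Module.End (S.Algebra k) (StringModule hw))
    (c : StringModule hw) : vec hw (f c) = (endMatrix f).mulVec (vec hw c) := by
  rw [endMatrix, LinearMap.toMatrix'_mulVec, toLinear_apply, AddEquiv.symm_apply_apply]

theorem endMatrix_comm {hw : w.IsString S k} (f : Module.End (S.Algebra k) (StringModule hw))
    (z : PathAlgebra k V) : endMatrix f * (w.matrixRep k hw.isWalk).algHom z =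
      (w.matrixRep k hw.isWalk).algHom z * endMatrix f := by
  apply Matrix.toLin'.injective
  refine LinearMap.ext fun c => ?_
  have h := congrArg (vec hw) (map_smul f (z : S.Algebra k) ((vec hw).symm c))
  rw [vec_end_apply, vec_mk_smul, vec_mk_smul, vec_end_apply, AddEquiv.apply_symm_apply] at h
  rw [Matrix.toLin'_apply, Matrix.toLin'_apply, ← Matrix.mulVec_mulVec, ← Matrix.mulVec_mulVec, h]

theorem endMatrix_comm_E {hw : w.IsString S k}
    (f : Module.End (S.Algebra k) (StringModule hw)) (a : V) :
    endMatrix f * (w.matrixRep k hw.isWalk).E a = (w.matrixRep k hw.isWalk).E a * endMatrix f := by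
  have h := endMatrix_comm f (PathAlgebra.ofPath k (Path.nil : Path a a))
  rwa [PathAlgebra.MatrixRep.algHom_ofPath] at h

theorem endMatrix_comm_T {hw : w.IsString S k}
    (f : Module.End (S.Algebra k) (StringModule hw)) (e : Total V) :
    endMatrix f * (w.matrixRep k hw.isWalk).T e.hom =
      (w.matrixRep k hw.isWalk).T e.hom * endMatrix f := by
  have h := endMatrix_comm f (PathAlgebra.ofPath k e.hom.toPath)
  rw [PathAlgebra.MatrixRep.algHom_ofPath] at h
  have h' : (w.matrixRep k hw.isWalk).path e.hom.toPath = (w.matrixRep k hw.isWalk).T e.hom :=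
    PathAlgebra.MatrixRep.T_mul_E _ _
  rwa [h'] at h

theorem mul_T_apply (hw : w.IsString S k) (F : Matrix (Fin (w.length + 1)) (Fin (w.length + 1)) k)
    {e : Total V} {i i' : Fin (w.length + 1)} (h : w.Step e i i') (j : Fin (w.length + 1)) :
    (F * (w.matrixRep k hw.isWalk).T e.hom) j i = F j i' := by
  classical
  rw [Matrix.mul_apply, Finset.sum_eq_single i']
  · simp only [matrixRep, Matrix.of_apply]
    rw [if_pos h, mul_one]
  · intro l _ hl
    simp only [matrixRep, Matrix.of_apply]
    rw [if_neg, mul_zero]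
    exact fun h' => hl (Fin.ext (Adj.unique hw.reduced (adj_true.2 h') (adj_true.2 h)))
  · simp

theorem T_mul_apply (hw : w.IsString S k) (F : Matrix (Fin (w.length + 1)) (Fin (w.length + 1)) k)
    {e : Total V} {j j' : Fin (w.length + 1)} (h : w.Step e j' j) (i : Fin (w.length + 1)) :
    ((w.matrixRep k hw.isWalk).T e.hom * F) j i = F j' i := by
  classical
  rw [Matrix.mul_apply, Finset.sum_eq_single j']
  · simp only [matrixRep, Matrix.of_apply]
    rw [if_pos h, one_mul]
  · intro l _ hl
    simp only [matrixRep, Matrix.of_apply]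
    rw [if_neg, zero_mul]
    exact fun h' => hl (Fin.ext (Adj.unique hw.reduced (adj_false.2 h') (adj_false.2 h)))
  · simp

theorem exists_of_mul_T_ne_zero (hw : w.IsString S k)
    {F : Matrix (Fin (w.length + 1)) (Fin (w.length + 1)) k}
    {e : Total V} {i j : Fin (w.length + 1)}
    (h : (F * (w.matrixRep k hw.isWalk).T e.hom) j i ≠ 0) :
    ∃ l : Fin (w.length + 1), w.Step e i l ∧ F j l ≠ 0 := by
  rw [Matrix.mul_apply] at h
  obtain ⟨l, -, hl⟩ := Finset.exists_ne_zero_of_sum_ne_zero h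
  refine ⟨l, ?_, left_ne_zero_of_mul hl⟩
  by_contra hs
  exact right_ne_zero_of_mul hl (if_neg hs)

theorem exists_of_T_mul_ne_zero (hw : w.IsString S k)
    {F : Matrix (Fin (w.length + 1)) (Fin (w.length + 1)) k}
    {e : Total V} {i j : Fin (w.length + 1)}
    (h : ((w.matrixRep k hw.isWalk).T e.hom * F) j i ≠ 0) :
    ∃ l : Fin (w.length + 1), w.Step e l j ∧ F l i ≠ 0 := by
  rw [Matrix.mul_apply] at h
  obtain ⟨l, -, hl⟩ := Finset.exists_ne_zero_of_sum_ne_zero h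
  refine ⟨l, ?_, right_ne_zero_of_mul hl⟩
  by_contra hs
  exact left_ne_zero_of_mul hl (if_neg hs)

/-- Compare entries in `F T = T F`. If `e` maps position `i'` to `i`, the entry `(j, i)` of `F` is
the entry `(j, i')` of `F T = T F`, which gives `back`; if `e` maps `j` to `j'`, it is the entry
`(j', i)` of `T F = F T`, which gives `forth`. -/
theorem isGraphLike_endMatrix {hw : w.IsString S k}
    (f : Module.End (S.Algebra k) (StringModule hw)) :
    w.IsGraphLike true fun i j => ∃ (hi : i < w.length + 1) (hj : j < w.length + 1),
      endMatrix f ⟨j, hj⟩ ⟨i, hi⟩ ≠ 0 where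
  le := fun ⟨hi, hj, _⟩ => ⟨Nat.lt_succ_iff.1 hi, Nat.lt_succ_iff.1 hj⟩
  vertex := by
    rintro i j ⟨hi, hj, h⟩
    have hc := congrFun (congrFun (endMatrix_comm_E f (w.vertex i)) ⟨j, hj⟩) ⟨i, hi⟩
    simp only [matrixRep, Matrix.mul_diagonal, Matrix.diagonal_mul] at hc
    by_contra hne
    rw [if_neg (Ne.symm hne), if_true, mul_one, zero_mul] at hc
    exact h hc
  back := by
    rintro i j e i' ⟨hi, hj, h⟩ hA
    have hi' := hA.le.2
    have hs : w.Step e i' i := adj_false.1 hA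
    rw [← mul_T_apply hw (endMatrix f) (i := ⟨i', by omega⟩) (i' := ⟨i, hi⟩) hs ⟨j, hj⟩,
      endMatrix_comm_T] at h
    obtain ⟨l, hl, hF⟩ := exists_of_T_mul_ne_zero hw h
    exact ⟨l, adj_false.2 hl, by omega, l.2, hF⟩
  forth := by
    rintro i j e j' ⟨hi, hj, h⟩ hA
    have hj' := hA.le.2
    have hs : w.Step e j j' := hA
    rw [← T_mul_apply hw (endMatrix f) (j := ⟨j', by omega⟩) (j' := ⟨j, hj⟩) hs ⟨i, hi⟩,
      ← endMatrix_comm_T] at h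
    obtain ⟨l, hl, hF⟩ := exists_of_mul_T_ne_zero hw h
    exact ⟨l, hl, l.2, by omega, hF⟩

/-- Rigidity removes the entries off the diagonal, and commuting with the arrow of a letter equates
the two diagonal entries at its ends. -/
theorem endMatrix_eq_smul_one (hr : w.IsRigid) {hw : w.IsString S k}
    (f : Module.End (S.Algebra k) (StringModule hw)) : endMatrix f = endMatrix f 0 0 • 1 := by
  have hoff : ∀ i j, j ≠ i → endMatrix f j i = 0 := by
    intro i j hij
    by_contra h
    exact hij (Fin.ext (hr _ (isGraphLike_endMatrix f) _ _ ⟨i.2, j.2, h⟩).symm)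
  have hstep : ∀ (e : Total V) (i j : Fin (w.length + 1)), w.Step e i j →
      endMatrix f j j = endMatrix f i i := by
    intro e i j hs
    rw [← mul_T_apply hw (endMatrix f) hs, endMatrix_comm_T, T_mul_apply hw (endMatrix f) hs]
  have hdiag : ∀ (i : ℕ) (hi : i < w.length + 1), endMatrix f ⟨i, hi⟩ ⟨i, hi⟩ = endMatrix f 0 0 := by
    intro i
    induction i with
    | zero => intro hi; rfl
    | succ i ih =>
      intro hi
      rw [← ih (by omega)]
      obtain ⟨⟨e, _ | _⟩, hc⟩ := w.exists_letter (i := i) (by omega)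
      · exact (hstep e ⟨i + 1, hi⟩ ⟨i, by omega⟩ (Or.inr ⟨rfl, hc⟩)).symm
      · exact hstep e ⟨i, by omega⟩ ⟨i + 1, hi⟩ (Or.inl ⟨rfl, hc⟩)
  ext j i
  by_cases hij : j = i
  · subst hij
    rw [Matrix.smul_apply, Matrix.one_apply_eq, smul_eq_mul, mul_one]
    exact hdiag j j.2
  · rw [hoff i j hij, Matrix.smul_apply, Matrix.one_apply_ne hij, smul_zero]

theorem isBrick (hr : w.IsRigid) (hw : w.IsString S k) :
    IsBrick (S.Algebra k) (StringModule hw) := by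
  constructor
  · have : Nontrivial (StringModule hw) :=
      inferInstanceAs (Nontrivial (Fin (w.length + 1) → k))
    infer_instance
  · intro f hf
    have hfc : ∀ c, vec hw (f c) = endMatrix f 0 0 • vec hw c := by
      intro c
      rw [vec_end_apply]
      conv_lhs => rw [endMatrix_eq_smul_one hr f]
      rw [Matrix.smul_mulVec, Matrix.one_mulVec]
    have h0 : endMatrix f 0 0 ≠ 0 := by
      intro h0
      apply hf
      refine LinearMap.ext fun c => (vec hw).injective ?_
      rw [hfc, h0, zero_smul, LinearMap.zero_apply, map_zero]
    rw [Module.End.isUnit_iff]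
    constructor
    · intro c d hcd
      have h := congrArg (vec hw) hcd
      rw [hfc, hfc] at h
      exact (vec hw).injective (smul_right_injective _ h0 h)
    · intro c
      refine ⟨(vec hw).symm ((endMatrix f 0 0)⁻¹ • vec hw c), (vec hw).injective ?_⟩
      rw [hfc, AddEquiv.apply_symm_apply, smul_inv_smul₀ h0]

end StringModule

end Word

/-- Two closed walks `P` and `Q` joined by a bar `b`, such that no arrow and no inner vertex
occurs twice, and such that the first and the last letters of `P` and `Q` and the first letter
of `b` have the same sign `σ`. -/
structure Dumbbell (V : Type v) [Quiver.{w} V] where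
  σ : Bool
  (P b Q : Word V)
  (headP lastP headQ lastQ headb : Total V)
  isWalk_P : P.IsWalk
  isWalk_b : b.IsWalk
  isWalk_Q : Q.IsWalk
  finish_P : P.finish = P.start
  start_b : b.start = P.start
  start_Q : Q.start = b.finish
  finish_Q : Q.finish = Q.start
  head_P : P.letters[0]? = some (headP, σ)
  last_P : P.letters[P.length - 1]? = some (lastP, σ)
  head_Q : Q.letters[0]? = some (headQ, σ)
  last_Q : Q.letters[Q.length - 1]? = some (lastQ, σ)
  head_b : b.letters[0]? = some (headb, σ)
  arrows_nodup : ((P.letters ++ b.letters ++ Q.letters).map Prod.fst).Nodup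
  vertices_nodup : (P.vertices.tail ++ b.vertices.tail ++ Q.vertices.tail.dropLast).Nodup

/-! ### The closed word `b⁻¹ Q b P`: its letters and vertices modulo the period -/

namespace Dumbbell

variable {V : Type v} [Quiver.{w} V] (D : Dumbbell V)

theorem length_P_pos : 0 < D.P.length := Word.lt_length_of_getElem? D.head_P

theorem length_Q_pos : 0 < D.Q.length := Word.lt_length_of_getElem? D.head_Q

theorem length_b_pos : 0 < D.b.length := Word.lt_length_of_getElem? D.head_b

/-- The word `Q b P`. -/
def half : Word V := D.Q.comp (D.b.comp D.P)

/-- The closed word `b⁻¹ Q b P`. -/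
def word : Word V := D.b.inv.comp D.half

theorem length_half : D.half.length = D.P.length + D.b.length + D.Q.length := by
  rw [half, Word.length_comp, Word.length_comp]

theorem length_word :
    D.word.length = D.P.length + D.b.length + D.Q.length + D.b.length := by
  rw [word, Word.length_comp, length_half, Word.length_inv]

theorem start_b' : D.b.start = D.P.finish := D.start_b.trans D.finish_P.symm

theorem start_Q' : D.Q.start = (D.b.comp D.P).finish := by
  rw [Word.finish_comp D.start_b', D.start_Q]

theorem start_b_inv : D.b.inv.start = D.half.finish := by
  rw [half, Word.finish_comp D.start_Q', D.finish_Q, D.start_Q]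
  rfl

theorem isWalk_word : D.word.IsWalk :=
  D.isWalk_b.inv.comp (D.isWalk_Q.comp (D.isWalk_b.comp D.isWalk_P D.start_b') D.start_Q')
    D.start_b_inv

theorem finish_word : D.word.finish = D.word.start := by
  rw [word, Word.finish_comp D.start_b_inv, Word.finish_inv D.isWalk_b, D.start_b]
  rfl

/-! ### The letters of the word -/

theorem getElem?_half_P {s : ℕ} (hs : s < D.P.length) :
    D.half.letters[s]? = D.P.letters[s]? := by
  rw [half, Word.getElem?_comp_left _ _ (by rw [Word.length_comp]; omega),
    Word.getElem?_comp_left _ _ hs]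

theorem getElem?_half_b {s : ℕ} (hs : s < D.b.length) :
    D.half.letters[D.P.length + s]? = D.b.letters[s]? := by
  rw [half, Word.getElem?_comp_left _ _ (by rw [Word.length_comp]; omega),
    Word.getElem?_comp_right]

theorem getElem?_half_Q (s : ℕ) :
    D.half.letters[D.P.length + D.b.length + s]? = D.Q.letters[s]? := by
  rw [half, ← Word.length_comp D.b D.P, Word.getElem?_comp_right]

theorem getElem?_word_half {r : ℕ} (hr : r < D.half.length) :
    D.word.letters[r]? = D.half.letters[r]? :=
  Word.getElem?_comp_left _ _ hr

theorem getElem?_word_back {r : ℕ} (h : D.half.length ≤ r) (hr : r < D.word.length) :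
    D.word.letters[r]? =
      (D.half.letters[D.P.length + (D.word.length - 1 - r)]?).map Letter.inv := by
  have h1 := D.length_half
  have h2 := D.length_word
  obtain ⟨s, rfl⟩ := Nat.exists_eq_add_of_le h
  rw [D.getElem?_half_b (by omega)]
  conv_lhs => rw [word]
  rw [Word.getElem?_comp_right, Word.getElem?_inv _ (by omega)]
  congr 2
  omega

/-- The index in `Q b P` of the arrow at the index `r` of `b⁻¹ Q b P`. -/
def fold (r : ℕ) : ℕ :=
  if r < D.half.length then r else D.P.length + (D.word.length - 1 - r)

theorem exists_half_letter {r : ℕ} {c : Letter V} (hc : D.word.letters[r]? = some c) :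
    ∃ c', D.half.letters[D.fold r]? = some c' ∧ c'.1 = c.1 := by
  have hr := Word.lt_length_of_getElem? hc
  unfold fold
  split_ifs with h
  · exact ⟨c, by rwa [← D.getElem?_word_half h], rfl⟩
  · rw [D.getElem?_word_back (not_lt.1 h) hr] at hc
    obtain ⟨c', hc', rfl⟩ := Option.map_eq_some_iff.1 hc
    exact ⟨c', hc', rfl⟩

theorem half_arrow_inj {i j : ℕ} {c c' : Letter V} (hc : D.half.letters[i]? = some c)
    (hc' : D.half.letters[j]? = some c') (h : c.1 = c'.1) : i = j := by
  have hl : D.half.letters = D.P.letters ++ D.b.letters ++ D.Q.letters := rfl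
  have hn := D.arrows_nodup
  rw [← hl] at hn
  have hi := (List.getElem?_eq_some_iff.1 hc).1
  refine (List.getElem?_inj (i := i) (by simpa using hi) hn).1 ?_
  rw [List.getElem?_map, List.getElem?_map, hc, hc']
  exact congrArg some h

theorem fold_eq_of_arrow {r i : ℕ} {c c' : Letter V} (hc : D.word.letters[r]? = some c)
    (hc' : D.half.letters[i]? = some c') (h : c.1 = c'.1) : D.fold r = i := by
  obtain ⟨c'', h1, h2⟩ := D.exists_half_letter hc
  exact D.half_arrow_inj h1 hc' (h2.trans h)

theorem half_headP : D.half.letters[0]? = some (D.headP, D.σ) := by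
  rw [D.getElem?_half_P D.length_P_pos, D.head_P]

theorem half_lastP : D.half.letters[D.P.length - 1]? = some (D.lastP, D.σ) := by
  have := D.length_P_pos
  rw [D.getElem?_half_P (by omega), D.last_P]

theorem half_headb : D.half.letters[D.P.length]? = some (D.headb, D.σ) := by
  rw [← D.head_b, ← D.getElem?_half_b D.length_b_pos, Nat.add_zero]

theorem half_headQ : D.half.letters[D.P.length + D.b.length]? = some (D.headQ, D.σ) := by
  rw [← D.head_Q, ← D.getElem?_half_Q, Nat.add_zero]

theorem half_lastQ : D.half.letters[D.half.length - 1]? = some (D.lastQ, D.σ) := by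
  have := D.length_Q_pos
  rw [← D.last_Q, ← D.getElem?_half_Q, D.length_half]
  congr 1
  omega

theorem headP_ne_headb : D.headP ≠ D.headb := fun h => by
  have h1 := D.half_arrow_inj D.half_headP D.half_headb h
  have := D.length_P_pos
  omega

theorem length_word_pos : 0 < D.word.length := by
  rw [length_word]
  have := D.length_P_pos
  omega

/-- Consecutive indices of a cyclic word. -/
theorem succ_mod_cases (i : ℕ) {L : ℕ} (hL : 0 < L) :
    ((i + 1) % L = i % L + 1 ∧ i % L + 1 < L) ∨ ((i + 1) % L = 0 ∧ i % L + 1 = L) := by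
  have h := Nat.mod_lt i hL
  rw [Nat.add_mod]
  rcases Nat.lt_or_ge (i % L + 1) L with h' | h'
  · left
    rw [Nat.mod_eq_of_lt (a := 1) (by omega), Nat.mod_eq_of_lt h']
    exact ⟨rfl, h'⟩
  · right
    refine ⟨?_, by omega⟩
    rw [← Nat.add_mod, ← Nat.mod_add_mod, show i % L + 1 = L by omega, Nat.mod_self]

/-- Mutually inverse letters have the same arrow, hence the same `fold`. But `fold` changes by one
at each step, except at the turns from `Q` to `b⁻¹` and from `b⁻¹` to `P`, where it changes because
`Q` and `P` are not empty. -/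
theorem reduced_pow (m : ℕ) : (D.word.pow m).letters.IsChain fun c d => d ≠ c.inv := by
  refine Word.isChain_of_getElem? fun i c d hc hd hcd => ?_
  have hi := Word.lt_length_of_getElem? hc
  have hi' := Word.lt_length_of_getElem? hd
  rw [Word.length_pow] at hi hi'
  rw [Word.getElem?_pow_mod _ hi] at hc
  rw [Word.getElem?_pow_mod _ hi'] at hd
  obtain ⟨c', h1, h2⟩ := D.exists_half_letter hc
  have h := D.fold_eq_of_arrow hd h1 (by rw [hcd, h2]; rfl)
  have hP := D.length_P_pos
  have hb := D.length_b_pos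
  have hQ := D.length_Q_pos
  have hh := D.length_half
  have hw := D.length_word
  rcases succ_mod_cases i D.length_word_pos with ⟨h3, h4⟩ | ⟨h3, h4⟩
  · rw [h3] at h
    unfold fold at h
    split_ifs at h <;> omega
  · rw [h3] at h
    unfold fold at h
    split_ifs at h <;> omega

/-- A letter of `P` or `Q` occurs only once in each period of a power, always with the same
sign. -/
theorem sign_of_half {m i s : ℕ} (hs : s < D.P.length ∨ D.P.length + D.b.length ≤ s)
    {e : Total V} {σ τ : Bool} (h : D.half.letters[s]? = some (e, σ))
    (hc : (D.word.pow m).letters[i]? = some (e, τ)) : τ = σ ∧ i % D.word.length = s := by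
  have hi := Word.lt_length_of_getElem? hc
  rw [Word.length_pow] at hi
  rw [Word.getElem?_pow_mod _ hi] at hc
  have hf := D.fold_eq_of_arrow hc h rfl
  have hw := D.length_word
  have hh := D.length_half
  have hr := Nat.mod_lt i D.length_word_pos
  unfold fold at hf
  split_ifs at hf with h'
  · rw [D.getElem?_word_half h', hf, h] at hc
    have := (Option.some.inj hc).symm
    exact ⟨(Prod.ext_iff.1 this).2, hf⟩
  · omega

/-- After `lastP` comes the index `|P|` of the period, while `headP` occurs only at the index `0`.
This covers a loop of one letter, for which the two arrows coincide. -/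
theorem lastP_not_headP {m i : ℕ} {τ τ' : Bool}
    (hc : (D.word.pow m).letters[i]? = some (D.lastP, τ)) :
    (D.word.pow m).letters[i + 1]? ≠ some (D.headP, τ') := by
  intro hd
  have hP := D.length_P_pos
  have hb := D.length_b_pos
  have hw := D.length_word
  have h1 := (D.sign_of_half (by omega) D.half_lastP hc).2
  have h2 := (D.sign_of_half (by omega) D.half_headP hd).2
  rcases succ_mod_cases i D.length_word_pos with ⟨h3, h4⟩ | ⟨h3, h4⟩ <;> omega

theorem lastQ_not_headQ {m i : ℕ} {τ τ' : Bool}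
    (hc : (D.word.pow m).letters[i]? = some (D.lastQ, τ)) :
    (D.word.pow m).letters[i + 1]? ≠ some (D.headQ, τ') := by
  intro hd
  have hP := D.length_P_pos
  have hQ := D.length_Q_pos
  have hb := D.length_b_pos
  have hw := D.length_word
  have hh := D.length_half
  have h1 := (D.sign_of_half (by omega) D.half_lastQ hc).2
  have h2 := (D.sign_of_half (by omega) D.half_headQ hd).2
  rcases succ_mod_cases i D.length_word_pos with ⟨h3, h4⟩ | ⟨h3, h4⟩ <;> omega

/-! ### The letters of the powers -/

theorem pow_headP {m a : ℕ} (ha : a < m) :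
    (D.word.pow m).letters[a * D.word.length]? = some (D.headP, D.σ) := by
  have h := D.word.getElem?_pow ha D.length_word_pos
  rw [Nat.add_zero] at h
  rw [h, D.getElem?_word_half (by rw [length_half]; have := D.length_P_pos; omega),
    D.half_headP]

theorem pow_half {m a s : ℕ} (ha : a < m) (hs : s < D.half.length) :
    (D.word.pow m).letters[a * D.word.length + s]? = D.half.letters[s]? := by
  rw [D.word.getElem?_pow ha (by rw [length_word, ← length_half]; omega),
    D.getElem?_word_half hs]

/-- Letters of `b⁻¹` are counted backwards from the end `c * D.word.length` of a period, so that `s`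
is the index of the same arrow in `b`. -/
theorem pow_back {m i c s : ℕ} (hc : c ≤ m) (hs : s < D.b.length)
    (hi : i + s + 1 = c * D.word.length) :
    (D.word.pow m).letters[i]? = (D.half.letters[D.P.length + s]?).map Letter.inv := by
  obtain ⟨a, rfl⟩ : ∃ a, c = a + 1 := Nat.exists_eq_succ_of_ne_zero (by rintro rfl; omega)
  rw [Nat.succ_mul] at hi
  have hw := D.length_word
  have hh := D.length_half
  have hi' : i = a * D.word.length + (D.word.length - 1 - s) := by omega
  rw [hi', D.word.getElem?_pow (by omega) (by omega), D.getElem?_word_back (by omega) (by omega)]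
  congr 3
  omega

theorem pow_last {m i c : ℕ} (hc : c ≤ m) (hi : i + 1 = c * D.word.length) :
    (D.word.pow m).letters[i]? = some (D.headb, !D.σ) := by
  rw [D.pow_back (s := 0) hc D.length_b_pos hi, Nat.add_zero, D.half_headb]
  rfl

/-! ### Positions at the same vertex -/

theorem half_vertices_tail_dropLast : D.half.vertices.tail.dropLast =
    D.P.vertices.tail ++ D.b.vertices.tail ++ D.Q.vertices.tail.dropLast := by
  have h : D.half.vertices.tail =
      D.P.vertices.tail ++ D.b.vertices.tail ++ D.Q.vertices.tail := by
    simp [half, Word.comp, Word.vertices]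
  have hQ := D.length_Q_pos
  rw [h, List.dropLast_append_of_ne_nil]
  intro h0
  have h1 := congrArg List.length h0
  rw [List.length_tail, Word.length_vertices, List.length_nil] at h1
  omega

/-- The two end positions must be left out: their vertices, the junctions, are met again at `|P|`
and `|P| + |b|`. -/
theorem half_vertex_inj {i j : ℕ} (hi : 0 < i) (hi' : i < D.half.length) (hj : 0 < j)
    (hj' : j < D.half.length) (h : D.half.vertex i = D.half.vertex j) : i = j := by
  have hn := D.vertices_nodup
  rw [← half_vertices_tail_dropLast] at hn
  obtain ⟨i, rfl⟩ := Nat.exists_eq_succ_of_ne_zero hi.ne'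
  obtain ⟨j, rfl⟩ := Nat.exists_eq_succ_of_ne_zero hj.ne'
  have hlen : D.half.vertices.tail.dropLast.length = D.half.length - 1 := by
    rw [List.length_dropLast, List.length_tail, Word.length_vertices]
    omega
  have key : ∀ t, t + 1 < D.half.length →
      D.half.vertices.tail.dropLast[t]? = some (D.half.vertex (t + 1)) := by
    intro t ht
    rw [List.getElem?_dropLast, if_pos (by
      rw [List.length_tail, Word.length_vertices]; omega), List.getElem?_tail,
      Word.vertices_getElem? _ ht.le]
  have hij : i = j := by
    refine (List.getElem?_inj (i := i) (by omega) hn).1 ?_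
    rw [key i hi', key j hj']
    exact congrArg some h
  rw [hij]

/-- The position in `Q b P` (neither the first nor the last one) at the same vertex as the
position `r` of `b⁻¹ Q b P`. -/
def foldVertex (r : ℕ) : ℕ :=
  if r = 0 then D.P.length else if r < D.half.length then r else
    D.P.length + (D.word.length - r)

theorem vertex_half_P {s : ℕ} (hs : s ≤ D.P.length) : D.half.vertex s = D.P.vertex s := by
  rw [half, Word.vertex_comp_left _ _ (by rw [Word.length_comp]; omega),
    Word.vertex_comp_left _ _ hs]

theorem vertex_half_b {s : ℕ} (hs : s ≤ D.b.length) :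
    D.half.vertex (D.P.length + s) = D.b.vertex s := by
  rw [half, Word.vertex_comp_left _ _ (by rw [Word.length_comp]; omega),
    Word.vertex_comp_right D.start_b' hs]

theorem vertex_word {r : ℕ} (hr : r ≤ D.word.length) :
    D.word.vertex r = D.half.vertex (D.foldVertex r) := by
  have hw := D.length_word
  have hh := D.length_half
  unfold foldVertex
  split_ifs with h0 h1
  · subst h0
    rw [D.vertex_half_P le_rfl]
    exact D.finish_P.symm
  · exact Word.vertex_comp_left _ _ h1.le
  · obtain ⟨s, rfl⟩ := Nat.exists_eq_add_of_le (not_lt.1 h1)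
    conv_lhs => rw [word]
    rw [Word.vertex_comp_right D.start_b_inv (by rw [Word.length_inv]; omega),
      Word.vertex_inv D.isWalk_b (by omega), D.vertex_half_b (by omega)]
    congr 1
    omega

theorem vertex_pow_mod {m i : ℕ} (hm : 0 < m) (hi : i ≤ m * D.word.length) :
    (D.word.pow m).vertex i = D.word.vertex (i % D.word.length) := by
  have hpos := D.length_word_pos
  rcases hi.lt_or_eq with hi | rfl
  · have h := Word.vertex_pow D.finish_word ((Nat.div_lt_iff_lt_mul hpos).2 hi)
      (Nat.mod_lt i hpos).le
    rwa [Nat.mul_comm, Nat.div_add_mod] at h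
  · rw [Nat.mul_mod_left]
    obtain ⟨n, rfl⟩ := Nat.exists_eq_succ_of_ne_zero hm.ne'
    rw [Nat.succ_mul, Word.vertex_pow D.finish_word (Nat.lt_succ_self n) le_rfl]
    exact D.finish_word

/-- The position `i` lies on a copy of `b` and the position `j` at the same vertex on a copy of
`b⁻¹`. -/
def IsOpposite (m i j : ℕ) : Prop :=
  ∃ s ≤ D.b.length, ∃ a < m, ∃ c ≤ m,
    i = a * D.word.length + D.P.length + s ∧ j + s = c * D.word.length

/-- Residue `0` counts as the end of a copy of `b⁻¹`. This includes the position `0`, which no such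
copy precedes; hence `c = 0` is possible and needs its own argument in `not_opposite_swap`. -/
theorem isOpposite_of_mod {m i j : ℕ} (hi : i ≤ m * D.word.length)
    (hj : j ≤ m * D.word.length) {s : ℕ} (hs : s ≤ D.b.length)
    (hi' : i % D.word.length = D.P.length + s)
    (hj' : j % D.word.length + s = D.word.length ∨ j % D.word.length = 0 ∧ s = 0) :
    D.IsOpposite m i j := by
  have hpos := D.length_word_pos
  have hP := D.length_P_pos
  have hQ := D.length_Q_pos
  have hw := D.length_word
  have hlt : ∀ {i}, i ≤ m * D.word.length → i % D.word.length ≠ 0 → i / D.word.length < m := by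
    intro i hi h
    refine (Nat.div_lt_iff_lt_mul hpos).2 (hi.lt_of_ne ?_)
    rintro rfl
    exact h (Nat.mul_mod_left _ _)
  have hia := Nat.div_add_mod i D.word.length
  have hja := Nat.div_add_mod j D.word.length
  rw [Nat.mul_comm] at hia hja
  refine ⟨s, hs, _, hlt hi (by omega), ?_⟩
  rcases hj' with hj' | ⟨hj', rfl⟩
  · refine ⟨j / D.word.length + 1, hlt hj (by omega), by omega, ?_⟩
    rw [Nat.succ_mul]
    omega
  · exact ⟨j / D.word.length, Nat.div_le_of_le_mul (by rwa [Nat.mul_comm]), by omega, by omega⟩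

/-- Positions at the same vertex have the same `foldVertex`, and this function identifies two
different residues only if they are the same place on the two passages of the bar. -/
theorem cases_of_vertex_eq {m i j : ℕ} (hm : 0 < m) (hi : i ≤ m * D.word.length)
    (hj : j ≤ m * D.word.length) (h : (D.word.pow m).vertex i = (D.word.pow m).vertex j) :
    i % D.word.length = j % D.word.length ∨ D.IsOpposite m i j ∨ D.IsOpposite m j i := by
  have hpos := D.length_word_pos
  have hP := D.length_P_pos
  have hb := D.length_b_pos
  have hQ := D.length_Q_pos
  have hw := D.length_word
  have hh := D.length_half
  have hri := Nat.mod_lt i hpos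
  have hrj := Nat.mod_lt j hpos
  have hI := D.isOpposite_of_mod hi hj (s := i % D.word.length - D.P.length)
  have hJ := D.isOpposite_of_mod hj hi (s := j % D.word.length - D.P.length)
  rw [D.vertex_pow_mod hm hi, D.vertex_pow_mod hm hj, D.vertex_word hri.le,
    D.vertex_word hrj.le] at h
  have hf : ∀ r, r < D.word.length → 0 < D.foldVertex r ∧ D.foldVertex r < D.half.length := by
    intro r hr
    unfold foldVertex
    split_ifs <;> omega
  have he := D.half_vertex_inj (hf _ hri).1 (hf _ hri).2 (hf _ hrj).1 (hf _ hrj).2 h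
  unfold foldVertex at he
  split_ifs at he
  · left; omega
  · right; right; exact hJ (by omega) (by omega) (by omega)
  · omega
  · right; left; exact hI (by omega) (by omega) (by omega)
  · left; omega
  · right; left; exact hI (by omega) (by omega) (by omega)
  · omega
  · right; right; exact hJ (by omega) (by omega) (by omega)
  · left; omega

end Dumbbell

/-! ### Exclusion of related pairs off the diagonal -/

namespace Dumbbell

variable {V : Type v} [Quiver.{w} V] (D : Dumbbell V)

/-! ### The powers are rigid -/

section GraphLike

variable {D} {m : ℕ} {R : ℕ → ℕ → Prop}

theorem shift_left (h : (D.word.pow m).IsGraphLike D.σ R) {r : ℕ} :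
    ∀ {i}, R i (i + r * D.word.length) → R 0 (r * D.word.length) := by
  intro i
  induction i with
  | zero => intro hR; rwa [Nat.zero_add] at hR
  | succ i ih =>
    intro hR
    have hle := (h.le hR).2
    rw [Word.length_pow] at hle
    have hle' := (h.le hR).1
    obtain ⟨⟨e, τ⟩, hc⟩ := Word.exists_letter (D.word.pow m) (i := i) (by omega)
    rw [Word.length_pow] at hle'
    have hc' : (D.word.pow m).letters[i + r * D.word.length]? = some (e, τ) := by
      rw [← hc, Word.getElem?_pow_mod _ (by omega), Word.getElem?_pow_mod _ (by omega),
        Nat.add_mul_mod_self_right]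
    exact ih (h.move (D.reduced_pow m) (τ := !τ) hR (Or.inr ⟨rfl, by rwa [Bool.not_not]⟩)
      (Or.inr ⟨by omega, by rwa [Bool.not_not]⟩))

theorem shift_right (h : (D.word.pow m).IsGraphLike D.σ R) {r : ℕ} (n : ℕ) :
    ∀ {j}, j + r * D.word.length + n = m * D.word.length → R (j + r * D.word.length) j →
      ∃ j', j' + r * D.word.length = m * D.word.length ∧ R (m * D.word.length) j' := by
  induction n with
  | zero => intro j hj hR; exact ⟨j, hj, by rwa [← hj]⟩
  | succ n ih =>
    intro j hj hR
    obtain ⟨⟨e, τ⟩, hc⟩ := Word.exists_letter (D.word.pow m) (i := j)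
      (by rw [Word.length_pow]; omega)
    have hc' : (D.word.pow m).letters[j + r * D.word.length]? = some (e, τ) := by
      rw [← hc, Word.getElem?_pow_mod _ (by omega), Word.getElem?_pow_mod _ (by omega),
        Nat.add_mul_mod_self_right]
    refine ih (j := j + 1) (by omega) ?_
    exact h.move (D.reduced_pow m) (τ := τ) hR (Or.inl ⟨by omega, hc'⟩) (Or.inl ⟨rfl, hc⟩)

/-- Slide left until the smaller position is `0`. The other one then ends a copy of `b⁻¹`, so
`forth` asks for a neighbour of `0` along `headb`; but the only letter at `0` is `headP`. -/
theorem not_parallel_lt (h : (D.word.pow m).IsGraphLike D.σ R) {i r : ℕ} (hr : 0 < r)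
    (hR : R i (i + r * D.word.length)) : False := by
  have h0 := shift_left h hR
  have hle := (h.le h0).2
  rw [Word.length_pow] at hle
  have hpos := D.length_word_pos
  have hrm : r ≤ m := Nat.le_of_mul_le_mul_right hle hpos
  have hrp : 0 < r * D.word.length := Nat.mul_pos hr hpos
  have hl := D.pow_last hrm (i := r * D.word.length - 1) (by omega)
  obtain ⟨i', hA, -⟩ := h.forth h0 (Or.inr ⟨by omega, hl⟩)
  rcases hA with ⟨-, hA⟩ | ⟨hA, -⟩
  · have hp := D.pow_headP (m := m) (a := 0) (by omega)
    rw [Nat.zero_mul, hA] at hp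
    exact D.headP_ne_headb (Prod.ext_iff.1 (Option.some.inj hp)).1.symm
  · omega

/-- Slide right until the larger position is the end of the word. The other one then begins a copy
of `P`, so `forth` asks for a neighbour along `headP` at the end; but the only letter there belongs
to `headb`. -/
theorem not_parallel_gt (h : (D.word.pow m).IsGraphLike D.σ R) {j r : ℕ} (hr : 0 < r)
    (hR : R (j + r * D.word.length) j) : False := by
  have hle := (h.le hR).1
  rw [Word.length_pow] at hle
  obtain ⟨j', hj', h0⟩ := shift_right h (m * D.word.length - (j + r * D.word.length))
    (by omega) hR
  have hpos := D.length_word_pos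
  have hrm : r ≤ m := Nat.le_of_mul_le_mul_right (by omega) hpos
  obtain ⟨a, rfl⟩ := Nat.exists_eq_add_of_le hrm
  have ha : j' = a * D.word.length := by rw [Nat.add_mul] at hj'; omega
  subst ha
  obtain ⟨i', hA, -⟩ := h.forth h0 (Or.inl ⟨rfl, D.pow_headP (by omega)⟩)
  rcases hA with ⟨-, hA⟩ | ⟨hA, hA'⟩
  · have := Word.lt_length_of_getElem? hA
    rw [Word.length_pow] at this
    omega
  · rw [D.pow_last le_rfl hA.symm] at hA'
    exact D.headP_ne_headb (Prod.ext_iff.1 (Option.some.inj hA')).1.symm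

theorem bar_letter {a s : ℕ} (ha : a < m) (hs : s < D.b.length) {e : Total V} {τ : Bool}
    (he : D.half.letters[D.P.length + s]? = some (e, τ)) :
    (D.word.pow m).Adj e τ (a * D.word.length + D.P.length + s)
      (a * D.word.length + D.P.length + (s + 1)) := by
  have hh := D.length_half
  refine Or.inl ⟨rfl, ?_⟩
  rw [Nat.add_assoc, D.pow_half ha (by omega), he]

theorem back_letter {c s j : ℕ} (hc : c ≤ m) (hs : s < D.b.length) {e : Total V} {τ : Bool}
    (he : D.half.letters[D.P.length + s]? = some (e, τ))
    (hj : j + s + 1 = c * D.word.length) : (D.word.pow m).Adj e τ (j + 1) j := by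
  refine Or.inr ⟨rfl, ?_⟩
  rw [D.pow_back hc hs hj, he]
  rfl

theorem exists_bar_letter {s : ℕ} (hs : s < D.b.length) :
    ∃ e τ, D.half.letters[D.P.length + s]? = some (e, τ) := by
  have hh := D.length_half
  obtain ⟨⟨e, τ⟩, h⟩ := D.half.exists_letter (i := D.P.length + s) (by omega)
  exact ⟨e, τ, h⟩

/-- Slide along the bar to the first junction. There `lastP` has sign `!σ` seen from the end of `P`,
whereas from a boundary of periods both possible neighbours, along `headP` and `headb`, have sign
`σ`. So `back` fails. -/
theorem not_opposite (h : (D.word.pow m).IsGraphLike D.σ R) {i j : ℕ} (hR : R i j)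
    (ho : D.IsOpposite m i j) : False := by
  obtain ⟨s, hs, a, ha, c, hc, rfl, hj⟩ := ho
  have h0 : R (a * D.word.length + D.P.length) (c * D.word.length) := by
    induction s generalizing j with
    | zero => rwa [← hj]
    | succ s ih =>
      obtain ⟨e, τ, he⟩ := exists_bar_letter (D := D) (s := s) (by omega)
      refine ih (by omega) (j := j + 1) (hj := by omega) ?_
      exact h.move (D.reduced_pow m) hR (Word.adj_not.2 (bar_letter ha hs he))
        (Word.adj_not.2 (back_letter hc hs he (by omega)))
  have hP := D.length_P_pos
  have hh := D.length_half
  have hl : (D.word.pow m).letters[a * D.word.length + (D.P.length - 1)]? =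
      some (D.lastP, D.σ) := by
    rw [D.pow_half ha (by omega), D.half_lastP]
  obtain ⟨j', hA, -⟩ := h.back h0 (e := D.lastP) (i' := a * D.word.length + (D.P.length - 1))
    (Or.inr ⟨by omega, by rw [Bool.not_not]; exact hl⟩)
  -- The signs are compared and not the arrows, since `lastP = headP` is possible.
  rcases hA with ⟨-, hA⟩ | ⟨hA, hA'⟩
  · have hlt := Word.lt_length_of_getElem? hA
    rw [Word.length_pow] at hlt
    rw [D.pow_headP (Nat.lt_of_mul_lt_mul_right hlt)] at hA
    have := (Prod.ext_iff.1 (Option.some.inj hA)).2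
    cases hσ : D.σ <;> simp [hσ] at this
  · rw [D.pow_last hc hA.symm] at hA'
    have := (Prod.ext_iff.1 (Option.some.inj hA')).2
    cases hσ : D.σ <;> simp [hσ] at this

/-- Slide along the bar to the second junction. There `back` asks the start of a copy of `Q` for a
neighbour along `lastQ` with sign `!σ`; on one side `headQ` has the wrong sign, on the other side
the arrow belongs to the bar. -/
theorem not_opposite_swap (h : (D.word.pow m).IsGraphLike D.σ R) {i j : ℕ} (hR : R i j)
    (ho : D.IsOpposite m j i) : False := by
  obtain ⟨s, hs, a, ha, c, hc, rfl, hi⟩ := ho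
  have hP := D.length_P_pos
  have hb := D.length_b_pos
  have hQ := D.length_Q_pos
  have hh := D.length_half
  have hw := D.length_word
  -- For `c = 0` the position `i` is the left end and cannot slide; here `forth` along `headb` fails
  -- at once.
  rcases Nat.eq_zero_or_pos c with rfl | hc0
  · obtain ⟨rfl, rfl⟩ : i = 0 ∧ s = 0 := by omega
    have he := D.half_headb
    rw [← Nat.add_zero D.P.length] at he
    obtain ⟨i', hA, -⟩ := h.forth hR (bar_letter ha hb he)
    rcases hA with ⟨-, hA⟩ | ⟨hA, -⟩
    · have hp := D.pow_headP (m := m) (a := 0) (by omega)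
      rw [Nat.zero_mul, hA] at hp
      exact D.headP_ne_headb (Prod.ext_iff.1 (Option.some.inj hp)).1.symm
    · omega
  obtain ⟨c, rfl⟩ : ∃ a, c = a + 1 := Nat.exists_eq_succ_of_ne_zero hc0.ne'
  have hcL : (c + 1) * D.word.length = c * D.word.length + D.word.length := Nat.succ_mul _ _
  -- The induction runs over the distance `n` to the second junction.
  have h0 : ∀ n i s, s + n = D.b.length → i + s = (c + 1) * D.word.length →
      R i (a * D.word.length + D.P.length + s) →
      R (c * D.word.length + D.half.length) (a * D.word.length + D.P.length + D.b.length) := by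
    intro n
    induction n with
    | zero =>
      intro i s hs hi hR
      rwa [show i = c * D.word.length + D.half.length by omega,
        show s = D.b.length by omega] at hR
    | succ n ih =>
      intro i s hs hi hR
      obtain ⟨e, τ, he⟩ := exists_bar_letter (D := D) (s := s) (by omega)
      obtain ⟨i, rfl⟩ : ∃ i', i = i' + 1 := Nat.exists_eq_succ_of_ne_zero (by omega)
      refine ih i (s + 1) (by omega) (by omega) ?_
      exact h.move (D.reduced_pow m) hR (back_letter hc (by omega) he (by omega))
        (bar_letter ha (by omega) he)
  have hR' := h0 _ i s (Nat.add_sub_cancel' hs) hi hR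
  have hl : (D.word.pow m).letters[c * D.word.length + (D.half.length - 1)]? =
      some (D.lastQ, D.σ) := by
    rw [D.pow_half (by omega) (by omega), D.half_lastQ]
  obtain ⟨j', hA, -⟩ := h.back hR' (e := D.lastQ)
    (i' := c * D.word.length + (D.half.length - 1)) (Or.inr ⟨by omega, by rw [Bool.not_not]; exact hl⟩)
  rcases hA with ⟨-, hA⟩ | ⟨hA, hA'⟩
  · rw [Nat.add_assoc, D.pow_half ha (by omega), D.half_headQ] at hA
    have := (Prod.ext_iff.1 (Option.some.inj hA)).2
    cases hσ : D.σ <;> simp [hσ] at this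
  · obtain rfl : j' = a * D.word.length + (D.P.length + (D.b.length - 1)) := by omega
    rw [D.pow_half ha (by omega)] at hA'
    have := D.half_arrow_inj hA' D.half_lastQ rfl
    omega

theorem eq_of_isGraphLike (hm : 0 < m) (h : (D.word.pow m).IsGraphLike D.σ R) {i j : ℕ}
    (hR : R i j) : i = j := by
  obtain ⟨hi, hj⟩ := h.le hR
  rw [Word.length_pow] at hi hj
  rcases D.cases_of_vertex_eq hm hi hj (h.vertex hR) with hp | ho | ho
  · by_contra hne
    have hi' := Nat.div_add_mod i D.word.length
    have hj' := Nat.div_add_mod j D.word.length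
    rw [Nat.mul_comm] at hi' hj'
    rcases Nat.lt_trichotomy (i / D.word.length) (j / D.word.length) with hlt | he | hlt
    · obtain ⟨r, hr⟩ := Nat.exists_eq_add_of_lt hlt
      refine not_parallel_lt h (i := i) (r := r + 1) (Nat.succ_pos r) ?_
      rw [hr, Nat.add_assoc, Nat.add_mul] at hj'
      rwa [show i + (r + 1) * D.word.length = j by omega]
    · rw [he] at hi'
      omega
    · obtain ⟨r, hr⟩ := Nat.exists_eq_add_of_lt hlt
      refine not_parallel_gt h (j := j) (r := r + 1) (Nat.succ_pos r) ?_
      rw [hr, Nat.add_assoc, Nat.add_mul] at hi'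
      rwa [show j + (r + 1) * D.word.length = i by omega]
  · exact (not_opposite h hR ho).elim
  · exact (not_opposite_swap h hR ho).elim

end GraphLike

theorem isRigid_pow {m : ℕ} (hm : 0 < m) : (D.word.pow m).IsRigid := by
  intro R h i j hR
  cases hσ : D.σ
  · have h' := h.swap
    rw [Bool.not_true, ← hσ] at h'
    exact (eq_of_isGraphLike hm h' hR).symm
  · rw [← hσ] at h
    exact eq_of_isGraphLike hm h hR

theorem isWalk_pow (m : ℕ) : (D.word.pow m).IsWalk := D.isWalk_word.pow D.finish_word m

end Dumbbell

/-! ### From barbells to dumbbells -/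

namespace Word

variable {V : Type v} [Quiver.{w} V]

theorem getElem?_inv_zero {u : Word V} (h : 0 < u.length) :
    u.inv.letters[0]? = (u.letters[u.length - 1]?).map Letter.inv := by
  rw [getElem?_inv u h, Nat.sub_zero]

theorem getElem?_inv_last {u : Word V} (h : 0 < u.length) :
    u.inv.letters[u.inv.length - 1]? = (u.letters[0]?).map Letter.inv := by
  rw [length_inv, getElem?_inv u (by omega), Nat.sub_self]

theorem map_fst_inv_perm (u : Word V) :
    (u.inv.letters.map Prod.fst).Perm (u.letters.map Prod.fst) := by
  rw [inv, List.map_reverse, List.map_map]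
  exact List.reverse_perm _

theorem vertices_eq_append {u : Word V} (h : 0 < u.length) :
    u.vertices = u.start :: (u.vertices.tail.dropLast ++ [u.finish]) := by
  have h1 : u.vertices.tail ≠ [] := by
    intro h0
    have h1 := congrArg List.length h0
    rw [List.length_tail, length_vertices, List.length_nil] at h1
    omega
  have h2 : u.vertices.tail.getLast h1 = u.finish := by
    have h3 := vertices_getElem? u (le_refl u.length)
    rw [List.getLast_eq_getElem, List.getElem_tail]
    rw [List.getElem?_eq_some_iff] at h3
    obtain ⟨h3, h4⟩ := h3
    rw [finish, ← h4]
    congr 1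
    rw [List.length_tail, length_vertices]
    omega
  conv_rhs => rw [← h2, List.dropLast_append_getLast h1]
  rfl

theorem tail_dropLast_inv {u : Word V} (hu : u.IsWalk) (h : 0 < u.length) :
    u.inv.vertices.tail.dropLast = u.vertices.tail.dropLast.reverse := by
  rw [vertices_inv hu]
  conv_lhs => rw [vertices_eq_append h]
  simp

theorem tail_inv_perm {u : Word V} (hu : u.IsWalk) (hc : u.finish = u.start) :
    u.inv.vertices.tail.Perm u.vertices.tail := by
  have h : (u.start :: u.inv.vertices.tail).Perm (u.start :: u.vertices.tail) := by
    have h1 : u.inv.vertices = u.start :: u.inv.vertices.tail := by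
      rw [← hc]
      rfl
    rw [← h1, vertices_inv hu]
    exact List.reverse_perm _
  exact h.cons_inv

end Word

namespace Dumbbell

variable {V : Type v} [Quiver.{w} V] (D : Dumbbell V)

/-- The alternatives are the two relations, each for both values of `D.σ`. Along the running
direction of a loop, its last letter is not followed by its first one; against this direction, the
letters would have the wrong sign. -/
theorem not_pass {m : ℕ} {e f : Total V}
    (h : (D.σ = true ∧ D.headP = f ∧ D.lastP = e) ∨ (D.σ = false ∧ D.headP = e ∧ D.lastP = f) ∨
      (D.σ = true ∧ D.headQ = f ∧ D.lastQ = e) ∨ (D.σ = false ∧ D.headQ = e ∧ D.lastQ = f))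
    (i : ℕ) :
    ¬ ((D.word.pow m).letters[i]? = some (e, true) ∧
        (D.word.pow m).letters[i + 1]? = some (f, true)) ∧
      ¬ ((D.word.pow m).letters[i]? = some (f, false) ∧
        (D.word.pow m).letters[i + 1]? = some (e, false)) := by
  have hP := D.length_P_pos
  have hQ := D.length_Q_pos
  have hh := D.length_half
  have signP : ∀ {i τ}, (D.word.pow m).letters[i]? = some (D.headP, τ) → τ = D.σ :=
    fun hc => (D.sign_of_half (by omega) D.half_headP hc).1
  have signQ : ∀ {i τ}, (D.word.pow m).letters[i]? = some (D.headQ, τ) → τ = D.σ :=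
    fun hc => (D.sign_of_half (by omega) D.half_headQ hc).1
  rcases h with ⟨hσ, rfl, rfl⟩ | ⟨hσ, rfl, rfl⟩ | ⟨hσ, rfl, rfl⟩ | ⟨hσ, rfl, rfl⟩
  · refine ⟨fun h => D.lastP_not_headP h.1 h.2, fun h => ?_⟩
    simpa [hσ] using signP h.1
  · refine ⟨fun h => ?_, fun h => D.lastP_not_headP h.1 h.2⟩
    simpa [hσ] using signP h.1
  · refine ⟨fun h => D.lastQ_not_headQ h.1 h.2, fun h => ?_⟩
    simpa [hσ] using signQ h.1
  · refine ⟨fun h => ?_, fun h => D.lastQ_not_headQ h.1 h.2⟩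
    simpa [hσ] using signQ h.1

end Dumbbell

theorem Word.matrixRep_path_toPath_comp_eq_zero {V : Type v} [Quiver.{w} V] [Fintype V]
    (k : Type u) [Field k] {u : Word V} (hu : u.IsWalk) {a b c : V} (e : a ⟶ b) (f : b ⟶ c)
    (h : ∀ i, ¬ (u.letters[i]? = some (⟨_, _, e⟩, true) ∧
        u.letters[i + 1]? = some (⟨_, _, f⟩, true)) ∧
      ¬ (u.letters[i]? = some (⟨_, _, f⟩, false) ∧
        u.letters[i + 1]? = some (⟨_, _, e⟩, false))) :
    (u.matrixRep k hu).path (e.toPath.comp f.toPath) = 0 := by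
  ext j i
  by_contra hne
  rcases matrixRep_path_ne_zero k u hu _ j i hne with ⟨-, h1⟩ | ⟨-, h1⟩
  · exact (h i).1 ⟨h1 0 Nat.two_pos, h1 1 Nat.one_lt_two⟩
  · exact (h j).2 ⟨h1 0 Nat.two_pos, h1 1 Nat.one_lt_two⟩

namespace Barbell

variable {V : Type v} [Quiver.{w} V] (B : Barbell V)

theorem CL_pos : 0 < B.CL.length := by
  have h := B.head_CL
  rw [List.head?_eq_getElem?] at h
  exact Word.lt_length_of_getElem? h

theorem CR_pos : 0 < B.CR.length := by
  have h := B.head_CR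
  rw [List.head?_eq_getElem?] at h
  exact Word.lt_length_of_getElem? h

theorem getElem?_CL_zero : B.CL.letters[0]? = some (⟨B.x, B.b, B.β⟩, true) := by
  rw [← List.head?_eq_getElem?, B.head_CL]

theorem getElem?_CL_last : B.CL.letters[B.CL.length - 1]? = some (⟨B.a, B.x, B.α⟩, true) := by
  rw [← B.last_CL, List.getLast?_eq_getElem?]
  rfl

theorem getElem?_CR_zero : B.CR.letters[0]? = some (⟨B.y, B.d, B.δ⟩, true) := by
  rw [← List.head?_eq_getElem?, B.head_CR]

theorem getElem?_CR_last : B.CR.letters[B.CR.length - 1]? = some (⟨B.c, B.y, B.γ⟩, true) := by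
  rw [← B.last_CR, List.getLast?_eq_getElem?]
  rfl

/-- Running through both loops backwards when the bar starts with an inverse letter gives all the
distinguished letters the sign of the bar. Both cases of the word thus have one form, and inverting
closed walks only permutes the lists of arrows and vertices. -/
theorem exists_dumbbell : ∃ D : Dumbbell V, D.word = B.word ∧
    ((D.σ = true ∧ D.headP = ⟨B.x, B.b, B.β⟩ ∧ D.lastP = ⟨B.a, B.x, B.α⟩ ∧
        D.headQ = ⟨B.y, B.d, B.δ⟩ ∧ D.lastQ = ⟨B.c, B.y, B.γ⟩) ∨
      (D.σ = false ∧ D.headP = ⟨B.a, B.x, B.α⟩ ∧ D.lastP = ⟨B.x, B.b, B.β⟩ ∧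
        D.headQ = ⟨B.c, B.y, B.γ⟩ ∧ D.lastQ = ⟨B.y, B.d, B.δ⟩)) := by
  have hL : B.CL.finish = B.CL.start := B.finish_CL.trans B.start_CL.symm
  have hR : B.CR.finish = B.CR.start := B.finish_CR.trans B.start_CR.symm
  by_cases hε : ∃ θ, B.bar.letters.head? = some (θ, true)
  · obtain ⟨θ, hθ⟩ := id hε
    refine ⟨{
      σ := true, P := B.CL, b := B.bar, Q := B.CR
      headP := _, lastP := _, headQ := _, lastQ := _, headb := θ
      isWalk_P := B.isWalk_CL, isWalk_b := B.isWalk_bar, isWalk_Q := B.isWalk_CR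
      finish_P := hL
      start_b := B.start_bar.trans B.start_CL.symm
      start_Q := B.start_CR.trans B.finish_bar.symm
      finish_Q := hR
      head_P := B.getElem?_CL_zero
      last_P := B.getElem?_CL_last
      head_Q := B.getElem?_CR_zero
      last_Q := B.getElem?_CR_last
      head_b := by rw [← List.head?_eq_getElem?, hθ]
      arrows_nodup := B.arrows_nodup
      vertices_nodup := B.vertices_nodup }, ?_, Or.inl ⟨rfl, rfl, rfl, rfl, rfl⟩⟩
    rw [word, if_pos hε]
    rfl
  · obtain ⟨⟨θ, τ⟩, hθ⟩ := B.bar.exists_letter B.bar_pos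
    obtain rfl : τ = false := by
      cases τ
      · rfl
      · exact absurd ⟨θ, by rw [List.head?_eq_getElem?, hθ]⟩ hε
    refine ⟨{
      σ := false, P := B.CL.inv, b := B.bar, Q := B.CR.inv
      headP := ⟨B.a, B.x, B.α⟩, lastP := ⟨B.x, B.b, B.β⟩
      headQ := ⟨B.c, B.y, B.γ⟩, lastQ := ⟨B.y, B.d, B.δ⟩, headb := θ
      isWalk_P := B.isWalk_CL.inv, isWalk_b := B.isWalk_bar, isWalk_Q := B.isWalk_CR.inv
      finish_P := (Word.finish_inv B.isWalk_CL).trans hL.symm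
      start_b := B.start_bar.trans B.finish_CL.symm
      start_Q := B.finish_CR.trans B.finish_bar.symm
      finish_Q := (Word.finish_inv B.isWalk_CR).trans hR.symm
      head_P := by rw [Word.getElem?_inv_zero B.CL_pos, B.getElem?_CL_last]; rfl
      last_P := by rw [Word.getElem?_inv_last B.CL_pos, B.getElem?_CL_zero]; rfl
      head_Q := by rw [Word.getElem?_inv_zero B.CR_pos, B.getElem?_CR_last]; rfl
      last_Q := by rw [Word.getElem?_inv_last B.CR_pos, B.getElem?_CR_zero]; rfl
      head_b := hθ
      arrows_nodup := by
        have h := B.arrows_nodup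
        rw [List.map_append, List.map_append] at h ⊢
        refine (List.Perm.nodup_iff ?_).2 h
        exact ((Word.map_fst_inv_perm _).append_right _).append (Word.map_fst_inv_perm _)
      vertices_nodup := by
        refine (List.Perm.nodup_iff ?_).2 B.vertices_nodup
        rw [Word.tail_dropLast_inv B.isWalk_CR B.CR_pos]
        exact ((Word.tail_inv_perm B.isWalk_CL hL).append_right _).append
          (List.reverse_perm _) }, ?_, Or.inr ⟨rfl, rfl, rfl, rfl, rfl⟩⟩
    rw [word, if_neg hε]
    rfl

theorem isRigid_pow {m : ℕ} (hm : 1 ≤ m) : (B.word.pow m).IsRigid := by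
  obtain ⟨D, hD, -⟩ := B.exists_dumbbell
  rw [← hD]
  exact D.isRigid_pow hm

theorem length_word_pos : 0 < B.word.length := by
  obtain ⟨D, hD, -⟩ := B.exists_dumbbell
  rw [← hD]
  exact D.length_word_pos

variable [Fintype V]

theorem isString_pow (k : Type u) [Field k] (m : ℕ) :
    (B.word.pow m).IsString B.relations k := by
  obtain ⟨D, hD, h⟩ := B.exists_dumbbell
  rw [← hD]
  refine Word.isString_of_path_eq_zero _ k (D.isWalk_pow m) (D.reduced_pow m) ?_
  rintro a b p (_ | _)
  · refine Word.matrixRep_path_toPath_comp_eq_zero k _ _ _ (D.not_pass ?_)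
    rcases h with ⟨hσ, h1, h2, -, -⟩ | ⟨hσ, h1, h2, -, -⟩
    · exact Or.inl ⟨hσ, h1, h2⟩
    · exact Or.inr (Or.inl ⟨hσ, h1, h2⟩)
  · refine Word.matrixRep_path_toPath_comp_eq_zero k _ _ _ (D.not_pass ?_)
    rcases h with ⟨hσ, -, -, h1, h2⟩ | ⟨hσ, -, -, h1, h2⟩
    · exact Or.inr (Or.inr (Or.inl ⟨hσ, h1, h2⟩))
    · exact Or.inr (Or.inr (Or.inr ⟨hσ, h1, h2⟩))

/-- The dimension of `M(w^m)` is `m` times the positive length of `w`, plus one. -/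
theorem eq_of_equiv (k : Type u) [Field k] {m n : ℕ}
    (f : Word.StringModule (B.isString_pow k m) ≃ₗ[B.Algebra k]
      Word.StringModule (B.isString_pow k n)) : m = n := by
  have h := Word.StringModule.length_eq_of_equiv f
  rw [Word.length_pow, Word.length_pow] at h
  exact Nat.eq_of_mul_eq_mul_right B.length_word_pos h

end Barbell

theorem mainTheorem8 {k : Type u} [Field k] {V : Type v} [Quiver.{w} V] [Fintype V]
    (B : Barbell V) :
    -- there are infinitely many isomorphism classes of bricks among the f.g. modules
    {X : Quotient (CategoryTheory.isIsomorphicSetoid (ModuleCat.{u} (B.Algebra k))) |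
      ∃ M : ModuleCat.{u} (B.Algebra k), X = Quotient.mk _ M ∧
        Module.Finite (B.Algebra k) M ∧ IsBrick (B.Algebra k) M}.Infinite ∧
    -- all the powers of the word are strings, and their string modules are such bricks
    ∃ hw : ∀ m : ℕ, 1 ≤ m → (B.word.pow m).IsString B.relations k,
      (∀ (m : ℕ) (hm : 1 ≤ m),
        Module.Finite (B.Algebra k) (Word.StringModule (hw m hm)) ∧
        IsBrick (B.Algebra k) (Word.StringModule (hw m hm))) ∧
      (∀ (m n : ℕ) (hm : 1 ≤ m) (hn : 1 ≤ n),
        Nonempty (Word.StringModule (hw m hm) ≃ₗ[B.Algebra k] Word.StringModule (hw n hn)) →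
          m = n) ∧
      -- all admissible pairs of factorisations of the powers are trivial
      (∀ (m : ℕ), 1 ≤ m → ∀ F G : (B.word.pow m).Factorization,
        F.IsAdmissible G → F.graphMap k G = LinearMap.id) := by
  have hbrick : ∀ m : ℕ, 1 ≤ m →
      Module.Finite (B.Algebra k) (Word.StringModule (B.isString_pow k m)) ∧
        IsBrick (B.Algebra k) (Word.StringModule (B.isString_pow k m)) := fun m hm =>
    ⟨Word.StringModule.finite _, Word.StringModule.isBrick (B.isRigid_pow hm) _⟩
  refine ⟨?_, fun m _ => B.isString_pow k m, hbrick, fun m n _ _ ⟨f⟩ => B.eq_of_equiv k f,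
    fun m hm F G h => (B.isRigid_pow hm).graphMap_eq_id (B.isString_pow k m).isWalk k h⟩
  -- The exponent is `n + 1`, since rigidity was shown for positive exponents.
  refine Set.infinite_of_injective_forall_mem (f := fun n : ℕ =>
    Quotient.mk (CategoryTheory.isIsomorphicSetoid (ModuleCat.{u} (B.Algebra k)))
      (ModuleCat.of (B.Algebra k) (Word.StringModule (B.isString_pow k (n + 1))))) ?_ ?_
  · intro m n h
    obtain ⟨e⟩ := Quotient.exact h
    exact Nat.succ_injective (B.eq_of_equiv k e.toLinearEquiv)
  · intro n
    exact ⟨_, rfl, hbrick (n + 1) (Nat.succ_pos n)⟩
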